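/- **Theorem (saltation matrix for transversal crossing).** Let $\Omega\subset\mathbb R^d$ be open, $T>0$, let $H:[0,T]\times\Omega\to\mathbb R$ be $C^1$ and $\Sigma(t)=\{x\in\Omega: H(t,x)=0\}$. Let $v$ be a velocity field on $[0,T]\times\Omega$ such that $v=f_1$ where $H<0$ and $v=f_2$ where $H>0$, where $f_1,f_2:[0,T]\times\Omega\to\mathbb R^d$ are continuous and have spatial Jacobians that exist and are continuous on $[0,T]\times\Omega$. Let $x_0\in\Omega$, and for every $y$ near $x_0$ let $t\mapsto\varphi_{0t}(y)\in\Omega$, $0\le t\le T$, be a Filippov solution of $\dot x=v(t,x)$, $x(0)=y$: an absolutely continuous curve whose derivative at almost every time equals $v(t,x)$ if $x\notin\Sigma(t)$, and is a convex combination of $f_1(t,x)$ and $f_2(t,x)$ if $x\in\Sigma(t)$. Suppose that the trajectory of $x_0$ hits $\Sigma$ for the first time at $t_1\in(0,T)$, at the point $x_1=\varphi_{0t_1}(x_0)$, and is off $\Sigma(t)$ for $t>t_1$ close to $t_1$. Let $v^\pm=\lim_{t\to t_1^\pm}v(t,\varphi_{0t}(x_0))$ be the velocities just before and after the crossing, and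 suppose that the crossing is transversal: $\nabla H(t_1,x_1)\ne0$, and the numbers $\nabla H(t_1,x_1)^Tv^-+\frac{\partial H}{\partial t}(t_1,x_1)$ and $\nabla H(t_1,x_1)^Tv^++\frac{\partial H}{\partial t}(t_1,x_1)$ are nonzero and have the same sign. Let $n=\nabla H(t_1,x_1)/\|\nabla H(t_1,x_1)\|$ be the unit normal to $\Sigma(t_1)$ at $x_1$. Then, for all $t\neq t_1$ close to $t_1$, the map $\varphi_{0t}$ is differentiable at $x_0$, the limits $D\varphi(t_1^\pm)=\lim_{t\to t_1^\pm}D\varphi_{0t}(x_0)$ exist, and there is exactly one matrix $S$ (the saltation matrix) with $D\varphi(t_1^+)=S\,D\varphi(t_1^-)$, namely $$S=I+\frac{(v^+-v^-)\,n^T}{n^Tv^-+\dfrac{1}{\|\nabla H(t_1,x_1)\|}\dfrac{\partial H}{\partial t}(t_1,x_1)} .$$ In particular, if $H$ is normalized so that $\|\nabla H(t_1,x_1)\|=1$, then $$S=I+\frac{(v^+-v^-)\,n^T}{n^Tv^-+\dfrac{\partial H}{\partial t}(t_1,x_1)} .$$ -/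

import Mathlib

open Set Filter Topology MeasureTheory

noncomputable section

namespace Saltation

/-- The phase space `ℝᵈ` with its Euclidean norm. -/
abbrev Space (d : ℕ) := EuclideanSpace ℝ (Fin d)

/-- A time-dependent vector field on `[0,T] × Ω` that is continuous, and continuously
differentiable in the space variable (with the Jacobian jointly continuous in time and space). -/
structure IsC1Field {d : ℕ} (T : ℝ) (Ω : Set (Space d)) (f : ℝ → Space d → Space d) : Prop where
  continuousOn : ContinuousOn (fun p : ℝ × Space d => f p.1 p.2) (Icc 0 T ×ˢ Ω)
  differentiableAt : ∀ t ∈ Icc 0 T, ∀ x ∈ Ω, DifferentiableAt ℝ (f t) x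
  continuousOn_fderiv :
    ContinuousOn (fun p : ℝ × Space d => fderiv ℝ (f p.1) p.2) (Icc 0 T ×ˢ Ω)

/-- `v` is a velocity field on `[0,T] × Ω` that is smooth off the moving switching boundary
`Σ(t) = {x ∈ Ω | H t x = 0}` and may jump across it: on the side `H < 0` it coincides with a
`C¹` field `f₁`, on the side `H > 0` with a `C¹` field `f₂`. Nothing is said about the values
of `v` on `Σ(t)`. -/
structure IsSwitchedField {d : ℕ} (T : ℝ) (Ω : Set (Space d)) (H : ℝ → Space d → ℝ)
    (v f₁ f₂ : ℝ → Space d → Space d) : Prop where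
  left_field : IsC1Field T Ω f₁
  right_field : IsC1Field T Ω f₂
  eq_left : ∀ t ∈ Icc 0 T, ∀ x ∈ Ω, H t x < 0 → v t x = f₁ t x
  eq_right : ∀ t ∈ Icc 0 T, ∀ x ∈ Ω, 0 < H t x → v t x = f₂ t x

open Classical in
/-- Filippov's convexification of a switched field: off the switching boundary the only
admissible velocity is `v t x`; on it, every convex combination of the two one-sided limits
is admissible. -/
def filippovSet {d : ℕ} (H : ℝ → Space d → ℝ) (v f₁ f₂ : ℝ → Space d → Space d)
    (t : ℝ) (x : Space d) : Set (Space d) :=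
  if H t x = 0 then segment ℝ (f₁ t x) (f₂ t x) else {v t x}

/-- `γ` is a Filippov solution in `Ω`, on the time interval `[0,T]`, of `γ' = v(t, γ)` with
`γ 0 = y`: an absolutely continuous curve (here: the integral of its integrable velocity `g`)
whose velocity is admissible at almost every time. -/
def IsFilippovSolution {d : ℕ} (T : ℝ) (Ω : Set (Space d)) (H : ℝ → Space d → ℝ)
    (v f₁ f₂ : ℝ → Space d → Space d) (y : Space d) (γ : ℝ → Space d) : Prop :=
  (∀ t ∈ Icc 0 T, γ t ∈ Ω) ∧
  ∃ g : ℝ → Space d, IntervalIntegrable g volume 0 T ∧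
    (∀ t ∈ Icc 0 T, γ t = y + ∫ s in (0 : ℝ)..t, g s) ∧
    ∀ᵐ t ∂(volume.restrict (Icc 0 T)), g t ∈ filippovSet H v f₁ f₂ t (γ t)

/-- The fundamental solution matrix `Dφ_{0t}(x)`: the Jacobian matrix at `x` of the time-`t`
map `φ t` of the flow. -/
def fundMatrix {d : ℕ} (φ : ℝ → Space d → Space d) (t : ℝ) (x : Space d) :
    Matrix (Fin d) (Fin d) ℝ :=
  Matrix.of fun i j => fderiv ℝ (φ t) x (EuclideanSpace.single j 1) i

/-- `S` is a saltation (jump) matrix at time `t₁` along the trajectory of `x₀`: the flow is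
differentiable at `x₀` for all times `t ≠ t₁` close to `t₁`, the limits `Dφ(t₁⁻)` and `Dφ(t₁⁺)`
of the fundamental solution matrix exist, and `Dφ(t₁⁺) = S Dφ(t₁⁻)`. -/
def IsSaltationMatrix {d : ℕ} (φ : ℝ → Space d → Space d) (t₁ : ℝ) (x₀ : Space d)
    (S : Matrix (Fin d) (Fin d) ℝ) : Prop :=
  (∀ᶠ t in 𝓝[≠] t₁, DifferentiableAt ℝ (φ t) x₀) ∧
  ∃ M₁ M₂ : Matrix (Fin d) (Fin d) ℝ,
    Tendsto (fun t => fundMatrix φ t x₀) (𝓝[<] t₁) (𝓝 M₁) ∧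
    Tendsto (fun t => fundMatrix φ t x₀) (𝓝[>] t₁) (𝓝 M₂) ∧
    M₂ = S * M₁

/-- The partial derivative `∂H/∂t` at `(t, x)`. -/
def timeDeriv {d : ℕ} (H : ℝ → Space d → ℝ) (t : ℝ) (x : Space d) : ℝ :=
  deriv (fun s => H s x) t

/-- The unit normal to `Σ(t) = {H(t,·) = 0}` at `x`, pointing to the side `H > 0`. -/
def unitNormal {d : ℕ} (H : ℝ → Space d → ℝ) (t : ℝ) (x : Space d) : Space d :=
  ‖gradient (H t) x‖⁻¹ • gradient (H t) x

/-- The rate of change of `H` at `(t, x)` along a motion with velocity `w`. -/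
def crossingRate {d : ℕ} (H : ℝ → Space d → ℝ) (t : ℝ) (x w : Space d) : ℝ :=
  inner ℝ (gradient (H t) x) w + timeDeriv H t x

/-- The trajectory `γ`, with velocity `vm` just before and `vp` just after time `t₁`, hits the
switching boundary for the first time at time `t₁`, leaves it immediately, and crosses it
transversally: at `(t₁, γ t₁)` the gradient of `H t₁` does not vanish, and the rates of change
of `H` for the two velocities are nonzero and have the same sign. -/
structure CrossesTransversally {d : ℕ} (H : ℝ → Space d → ℝ) (v : ℝ → Space d → Space d)
    (γ : ℝ → Space d) (t₁ : ℝ) (vm vp : Space d) : Prop where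
  before : ∀ t ∈ Ico 0 t₁, H t (γ t) ≠ 0
  hit : H t₁ (γ t₁) = 0
  after : ∀ᶠ t in 𝓝[>] t₁, H t (γ t) ≠ 0
  velocity_before : Tendsto (fun t => v t (γ t)) (𝓝[<] t₁) (𝓝 vm)
  velocity_after : Tendsto (fun t => v t (γ t)) (𝓝[>] t₁) (𝓝 vp)
  gradient_ne_zero : gradient (H t₁) (γ t₁) ≠ 0
  transversal : 0 < crossingRate H t₁ (γ t₁) vm * crossingRate H t₁ (γ t₁) vp

end Saltation

end

/-! Compare the reference trajectory `γ` with a neighbour started at `x₀ + ξ`. While both follow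
`f₁`, their difference is `Φ₁(t) ξ + o(ξ)`, where `Φ₁` solves the variational equation; once both
have crossed, the difference evolves in the same way under `f₂`. Between the two crossing times the
earlier curve already follows `f₂` while the later one still follows `f₁`, so the difference changes
by the delay times `v⁺ - v⁻`. Let `w` be the difference, earlier minus later, at the first of the
two crossings. There `H` is about `-DH(0, w)` on the later curve and grows at rate about `DH(1,
v⁻)`, so to first order the delay is `DH(0, w) / DH(1, v⁻)`. Hence the difference is transformed by
`saltationMap`, whichever curve crosses first (`eventually_jump`, `isLittleO_jump`). Composing the
three phases and letting `t → t₁` gives the left limit `M = Φ₁(t₁)` and the right limit `S M`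
(`exists_tendsto_fderiv`); `S` is unique because `M` is invertible.

The Filippov condition enters only through mean velocities (`IsSwitchedCurve`): the average velocity
lies in every closed convex set containing the relevant values of `f₁` and `f₂`. Near the crossing
point both fields raise `H` at a positive rate, hence so do all their convex combinations
(`exists_rate`). So there is no sliding, and neighbours cross exactly once, with crossing time and
path at distance `O(ξ)` from the reference (`exists_crossesNear`). This a priori bound makes all the
remainders `o(ξ)`. Downward crossings become upward ones under `H ↦ -H`, `f₁ ↔ f₂`, which leaves `S`
unchanged. -/

namespace Saltation

/-! ### Continuity arguments, linear differential equations and Grönwall estimates. -/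

section Generic

/-- A continuity argument: if the bound `‖w‖ ≤ R` up to time `t` improves to `‖w t‖ < R`, then
it never fails. -/
theorem norm_lt_of_bootstrap {E : Type*} [NormedAddCommGroup E] {w : ℝ → E} {a b R : ℝ} (hw : ContinuousOn w (Icc a b))
    (himp : ∀ t ∈ Icc a b, (∀ r ∈ Ico a t, ‖w r‖ < R) → ‖w t‖ < R) :
    ∀ t ∈ Icc a b, ‖w t‖ < R := by
  by_contra! hcon
  obtain ⟨t, ht, hRt⟩ := hcon
  -- The bad set is closed, so its infimum is a first bad time; all earlier times are good, and
  -- `himp` applies there.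
  set B : Set ℝ := {r ∈ Icc a b | R ≤ ‖w r‖} with hB
  have hBc : IsClosed B := by
    have : B = Icc a b ∩ (fun r => ‖w r‖) ⁻¹' Ici R := by
      ext r; simp [hB]
    rw [this]
    exact hw.norm.preimage_isClosed_of_isClosed isClosed_Icc isClosed_Ici
  have hBb : BddBelow B := ⟨a, fun r hr => hr.1.1⟩
  have hmem : sInf B ∈ B := hBc.csInf_mem ⟨t, ht, hRt⟩ hBb
  refine absurd (himp _ hmem.1 fun r hr => ?_) (not_lt.2 hmem.2)
  by_contra! hr'
  exact absurd (csInf_le hBb ⟨⟨hr.1, hr.2.le.trans hmem.1.2⟩, hr'⟩) (not_le.2 hr.2)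

variable {E : Type*} [NormedAddCommGroup E] [NormedSpace ℝ E]

theorem gronwallBound_le {δ K ε x : ℝ} (hK : 1 ≤ K) (hε : 0 ≤ ε) :
    gronwallBound δ K ε x ≤ (δ + ε) * Real.exp (K * x) := by
  rw [gronwallBound_of_K_ne_0 (by positivity)]
  have h1 : ε / K ≤ ε := div_le_self hε hK
  have h2 := Real.exp_pos (K * x)
  have h3 : 0 ≤ ε / K := by positivity
  simp only
  nlinarith

/-- Forward solutions of the linear equation `X' = B(t) X`, over a short time. -/
theorem exists_linear_solution_short [CompleteSpace E] {a b K : ℝ} (hK : 0 < K) (hab : a ≤ b)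
    (B : ℝ → E →L[ℝ] E) (hB : ContinuousOn B (Icc a b)) (hBK : ∀ t ∈ Icc a b, ‖B t‖ ≤ K)
    (hshort : 2 * K * (b - a) ≤ 1) (X₀ : E) :
    ∃ X : ℝ → E, X a = X₀ ∧ ContinuousOn X (Icc a b) ∧
      ∀ t ∈ Ico a b, HasDerivWithinAt X (B t (X t)) (Ici t) t := by
  lift K to NNReal using hK.le
  -- On the ball of radius `‖X₀‖ + 1` about `X₀` the speed is at most `K (2‖X₀‖ + 1)`. The radius
  -- scales with `X₀`, so the admissible time step depends on `K` only.
  have hpl : IsPicardLindelof (fun t x => B t x) (⟨a, left_mem_Icc.2 hab⟩ : Icc a b) X₀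
      (‖X₀‖₊ + 1) 0 (K * (2 * ‖X₀‖₊ + 1)) K := by
    refine ⟨fun t ht => ?_, fun x _ => ?_, fun t ht x hx => ?_, ?_⟩
    · refine LipschitzOnWith.of_dist_le_mul fun x _ y _ => ?_
      rw [dist_eq_norm, dist_eq_norm, ← map_sub]
      exact (B t).le_of_opNorm_le (hBK t ht) _
    · exact hB.clm_apply continuousOn_const
    · refine ((B t).le_of_opNorm_le (hBK t ht) _).trans ?_
      have hx' : ‖x‖ ≤ 2 * ‖X₀‖ + 1 := by
        have h1 : ‖x - X₀‖ ≤ ‖X₀‖ + 1 := by simpa [dist_eq_norm] using hx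
        have h2 := norm_le_norm_add_norm_sub' x X₀
        linarith
      simpa using mul_le_mul_of_nonneg_left hx' K.coe_nonneg
    · have h1 : max (b - a) (a - a) = b - a := by simp [hab]
      have h2 : 0 ≤ ‖X₀‖ := norm_nonneg _
      have h3 : K * (2 * ‖X₀‖ + 1) * max (b - a) (a - a) ≤ ‖X₀‖ + 1 - 0 := by
        rw [h1]; nlinarith
      simpa using h3
  obtain ⟨X, hX, hX'⟩ := hpl.exists_eq_forall_mem_Icc_hasDerivWithinAt₀
  refine ⟨X, hX, fun t ht => (hX' t ht).continuousWithinAt, fun t ht => ?_⟩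
  refine (hX' t ⟨ht.1, ht.2.le⟩).mono_of_mem_nhdsWithin ?_
  exact Filter.mem_of_superset (Icc_mem_nhdsGE ht.2) (Icc_subset_Icc_left ht.1)

/-- Forward solutions of the linear equation `X' = B(t) X` exist globally. -/
theorem exists_linear_solution [CompleteSpace E] {a b : ℝ} (hab : a ≤ b)
    (B : ℝ → E →L[ℝ] E) (hB : ContinuousOn B (Icc a b)) (X₀ : E) :
    ∃ X : ℝ → E, X a = X₀ ∧ ContinuousOn X (Icc a b) ∧
      ∀ t ∈ Ico a b, HasDerivWithinAt X (B t (X t)) (Ici t) t := by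
  obtain ⟨K, hK⟩ := isCompact_Icc.exists_bound_of_continuousOn hB
  -- One step length serves every initial value, so finitely many short solutions glue to a global
  -- one.
  obtain ⟨h, hh, hKh⟩ : ∃ h : ℝ, 0 < h ∧ 2 * (|K| + 1) * h ≤ 1 :=
    ⟨1 / (2 * (|K| + 1)), by positivity, by field_simp; exact le_rfl⟩
  have hK' : ∀ t ∈ Icc a b, ‖B t‖ ≤ |K| + 1 := fun t ht => by
    have := hK t ht; have := le_abs_self K; linarith
  have key : ∀ n : ℕ, ∀ c ∈ Icc a b, c - a ≤ n * h →
      ∃ X : ℝ → E, X a = X₀ ∧ ContinuousOn X (Icc a c) ∧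
        ∀ t ∈ Ico a c, HasDerivWithinAt X (B t (X t)) (Ici t) t := by
    intro n
    induction n with
    | zero =>
      intro c hc hch
      have : c = a := le_antisymm (by simpa using hch) hc.1
      subst this
      exact ⟨fun _ => X₀, rfl, continuousOn_const, fun t ht => by simp at ht⟩
    | succ n ih =>
      intro c hc hch
      push_cast at hch
      have hm : max a (c - h) ∈ Icc a b :=
        ⟨le_max_left _ _, max_le hab ((sub_le_self _ hh.le).trans hc.2)⟩
      set m := max a (c - h) with hmdef
      have hmc : m ≤ c := max_le hc.1 (sub_le_self _ hh.le)
      have hcm : c - m ≤ h := by have := le_max_right a (c - h); linarith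
      have hn0 : 0 ≤ n * h := by positivity
      obtain ⟨X, hXa, hXc, hX⟩ := ih m hm
        (by rw [hmdef, sub_le_iff_le_add]; exact max_le (by linarith) (by linarith))
      have hsub : Icc m c ⊆ Icc a b := Icc_subset_Icc hm.1 hc.2
      obtain ⟨Y, hYm, hYc, hY⟩ := exists_linear_solution_short (K := |K| + 1) (by positivity) hmc B
        (hB.mono hsub) (fun t ht => hK' t (hsub ht))
        (by nlinarith [abs_nonneg K]) (X m)
      refine ⟨fun t => if t ≤ m then X t else Y t, by simp [hm.1, hXa], ?_, fun t ht => ?_⟩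
      · have : Icc a c = Icc a m ∪ Icc m c := (Icc_union_Icc_eq_Icc hm.1 hmc).symm
        rw [this]
        refine ContinuousOn.union_of_isClosed ?_ ?_ isClosed_Icc isClosed_Icc
        · exact hXc.congr fun t ht => by simp [ht.2]
        · refine hYc.congr fun t ht => ?_
          rcases ht.1.eq_or_lt with rfl | h
          · simp [hYm]
          · simp [not_le.2 h]
      · rcases lt_or_ge t m with htm | htm
        · simp only [htm.le, if_true]
          refine (hX t ⟨ht.1, htm⟩).congr_of_eventuallyEq ?_ (by simp [htm.le])
          filter_upwards [Icc_mem_nhdsGE htm] with r hr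
          simp [hr.2]
        · have e : ∀ r, m ≤ r → (if r ≤ m then X r else Y r) = Y r := fun r hr => by
            rcases hr.eq_or_lt with rfl | h
            · simp [hYm]
            · simp [not_le.2 h]
          simp only [e t htm]
          refine (hY t ⟨htm, ht.2⟩).congr (fun r hr => e r (htm.trans hr)) (e t htm)
  obtain ⟨n, hn⟩ := exists_nat_ge ((b - a) / h)
  exact key n b (right_mem_Icc.2 hab) (by rwa [div_le_iff₀ hh] at hn)

/-- The fundamental solution `Φ' = A(t) Φ`, `Φ(a) = 1`, exists and is left invertible. -/
theorem exists_fundamental_solution [CompleteSpace E] {a b : ℝ} (hab : a ≤ b)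
    (A : ℝ → E →L[ℝ] E) (hA : ContinuousOn A (Icc a b)) :
    ∃ Φ Ψ : ℝ → E →L[ℝ] E, Φ a = 1 ∧ ContinuousOn Φ (Icc a b) ∧
      (∀ t ∈ Ico a b, HasDerivWithinAt Φ (A t * Φ t) (Ici t) t) ∧
      ∀ t ∈ Icc a b, Ψ t * Φ t = 1 := by
  obtain ⟨Φ, hΦa, hΦc, hΦ⟩ := exists_linear_solution hab
    (fun t => ContinuousLinearMap.mul ℝ (E →L[ℝ] E) (A t))
    ((ContinuousLinearMap.continuous _).comp_continuousOn hA) 1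
  -- `Ψ` solves the adjoint equation `Ψ' = -Ψ A`, so `Ψ Φ` has right derivative zero and keeps its
  -- initial value `1`.
  obtain ⟨Ψ, hΨa, hΨc, hΨ⟩ := exists_linear_solution hab
    (fun t => (ContinuousLinearMap.mul ℝ (E →L[ℝ] E)).flip (-A t))
    ((ContinuousLinearMap.continuous _).comp_continuousOn hA.neg) 1
  simp only [ContinuousLinearMap.flip_apply, ContinuousLinearMap.mul_apply'] at hΦ hΨ
  refine ⟨Φ, Ψ, hΦa, hΦc, hΦ, fun t ht => ?_⟩
  have := constant_of_has_deriv_right_zero (f := fun t => Ψ t * Φ t) (hΨc.mul hΦc)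
    (fun t ht => by
      have := (hΨ t ht).mul (hΦ t ht)
      convert! this using 1
      noncomm_ring) t ht
  simpa [hΦa, hΨa] using this

/-- Grönwall's inequality for `w' = A(t) w + O(ε ‖w‖)`. -/
theorem norm_le_of_almost_linear {A : ℝ → E →L[ℝ] E} {w w' : ℝ → E} {a b K ε : ℝ}
    (hw : ContinuousOn w (Icc a b)) (hw' : ∀ t ∈ Ico a b, HasDerivWithinAt w (w' t) (Ici t) t)
    (hA : ∀ t ∈ Ico a b, ‖A t‖ ≤ K)
    (hε : ∀ t ∈ Ico a b, ‖w' t - A t (w t)‖ ≤ ε * ‖w t‖) :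
    ∀ t ∈ Icc a b, ‖w t‖ ≤ ‖w a‖ * Real.exp ((K + ε) * (t - a)) := by
  intro t ht
  have := norm_le_gronwallBound_of_norm_deriv_right_le (K := K + ε) (ε := 0) hw hw' le_rfl
    (fun r hr => by
      have h1 := (A r).le_of_opNorm_le (hA r hr) (w r)
      have h2 := hε r hr
      have h3 := norm_le_norm_add_norm_sub' (w' r) (A r (w r))
      linarith) t ht
  rwa [gronwallBound_ε0] at this

/-- Comparison of `w' = A(t) w + O(ε ‖w‖)` with the linear equation `z' = A(t) z`. -/
theorem norm_sub_le_of_almost_linear {A : ℝ → E →L[ℝ] E} {w w' z : ℝ → E} {a b K ε M : ℝ}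
    (hK1 : 1 ≤ K) (hε0 : 0 ≤ ε)
    (hw : ContinuousOn w (Icc a b)) (hw' : ∀ t ∈ Ico a b, HasDerivWithinAt w (w' t) (Ici t) t)
    (hz : ContinuousOn z (Icc a b)) (hz' : ∀ t ∈ Ico a b, HasDerivWithinAt z (A t (z t)) (Ici t) t)
    (hA : ∀ t ∈ Ico a b, ‖A t‖ ≤ K) (hM : ∀ t ∈ Ico a b, ‖w t‖ ≤ M) (hM0 : 0 ≤ M)
    (hε : ∀ t ∈ Ico a b, ‖w' t - A t (w t)‖ ≤ ε * ‖w t‖) :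
    ∀ t ∈ Icc a b, ‖w t - z t‖ ≤ (‖w a - z a‖ + ε * M) * Real.exp (K * (t - a)) := by
  intro t ht
  have := norm_le_gronwallBound_of_norm_deriv_right_le (K := K) (ε := ε * M) (hw.sub hz)
    (fun r hr => (hw' r hr).sub (hz' r hr)) le_rfl
    (fun r hr => by
      have h1 := (A r).le_of_opNorm_le (hA r hr) (w r - z r)
      have h2 := hε r hr
      have h3 : w' r - A r (z r) = (w' r - A r (w r)) + A r (w r - z r) := by
        rw [map_sub]; abel
      rw [h3]
      refine (norm_add_le _ _).trans ?_
      have h4 := mul_le_mul_of_nonneg_left (hM r hr) hε0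
      simp only [Pi.sub_apply]
      linarith) t ht
  exact this.trans (gronwallBound_le hK1 (by positivity))

end Generic

/-! ### Switched curves, described by mean velocities. -/

section Curves

variable {E : Type*} [NormedAddCommGroup E] [NormedSpace ℝ E]

/-- A curve driven by `f₁` where `H < 0`, by `f₂` where `H > 0` and by convex combinations on
`H = 0`, expressed through its mean velocities. -/
structure IsSwitchedCurve (T : ℝ) (Ω : Set E) (H : ℝ → E → ℝ) (f₁ f₂ : ℝ → E → E)
    (x : ℝ → E) : Prop where
  mem : ∀ t ∈ Icc 0 T, x t ∈ Ω
  continuousOn : ContinuousOn x (Icc 0 T)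
  mean : ∀ s t, 0 ≤ s → s < t → t ≤ T → ∀ C : Set E, IsClosed C → Convex ℝ C →
    (∀ r ∈ Ioo s t, (H r (x r) ≤ 0 → f₁ r (x r) ∈ C) ∧ (0 ≤ H r (x r) → f₂ r (x r) ∈ C)) →
    ∃ u ∈ C, x t - x s = (t - s) • u

theorem IsSwitchedCurve.symm {T : ℝ} {Ω : Set E} {H : ℝ → E → ℝ} {f₁ f₂ : ℝ → E → E} {x : ℝ → E}
    (hx : IsSwitchedCurve T Ω H f₁ f₂ x) :
    IsSwitchedCurve T Ω (fun t x => -H t x) f₂ f₁ x where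
  mem := hx.mem
  continuousOn := hx.continuousOn
  mean s t hs hst ht C hC hC' h := hx.mean s t hs hst ht C hC hC' fun r hr =>
    ⟨fun h0 => (h r hr).2 (by linarith), fun h0 => (h r hr).1 (by linarith)⟩

/-- `x` is a forward solution of `x' = f(t, x)` on `[a, b]`. -/
structure IsForwardSolution (f : ℝ → E → E) (x : ℝ → E) (a b : ℝ) : Prop where
  continuousOn : ContinuousOn x (Icc a b)
  hasDeriv : ∀ t ∈ Ico a b, HasDerivWithinAt x (f t (x t)) (Ici t) t

theorem IsSwitchedCurve.continuousOn_comp {F : Type*} [TopologicalSpace F] {T : ℝ} {Ω : Set E}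
    {H : ℝ → E → ℝ} {f₁ f₂ : ℝ → E → E} {x : ℝ → E} (hx : IsSwitchedCurve T Ω H f₁ f₂ x)
    {g : ℝ → E → F} (hg : ContinuousOn (fun p : ℝ × E => g p.1 p.2) (Icc 0 T ×ˢ Ω)) :
    ContinuousOn (fun t => g t (x t)) (Icc 0 T) :=
  hg.comp (continuousOn_id.prodMk hx.continuousOn) fun t ht => ⟨ht, hx.mem t ht⟩

/-- Continuity keeps `f₁` along the curve in a small closed ball just after `r`. The ball is convex,
so the difference quotients lie in it too and converge to its centre. -/
theorem IsSwitchedCurve.isForwardSolution_left {T : ℝ} {Ω : Set E} {H : ℝ → E → ℝ}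
    {f₁ f₂ : ℝ → E → E} {x : ℝ → E} (hx : IsSwitchedCurve T Ω H f₁ f₂ x)
    (hf : ContinuousOn (fun p : ℝ × E => f₁ p.1 p.2) (Icc 0 T ×ˢ Ω)) {s t : ℝ} (hs : 0 ≤ s)
    (ht : t ≤ T) (hneg : ∀ r ∈ Ioo s t, H r (x r) < 0) : IsForwardSolution f₁ x s t := by
  refine ⟨hx.continuousOn.mono (Icc_subset_Icc hs ht), fun r hr => ?_⟩
  rw [hasDerivWithinAt_iff_isLittleO, Asymptotics.isLittleO_iff]
  intro c hc
  have hr0 : r ∈ Icc 0 T := ⟨hs.trans hr.1, hr.2.le.trans ht⟩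
  have hcont := hx.continuousOn_comp hf r hr0
  have hev : ∀ᶠ q in 𝓝[≥] r, f₁ q (x q) ∈ Metric.closedBall (f₁ r (x r)) c ∧ q < t := by
    refine Filter.Eventually.and ?_ (nhdsWithin_le_nhds (Iio_mem_nhds hr.2))
    have h1 : 𝓝[≥] r ≤ 𝓝[Icc 0 T] r := by
      refine nhdsWithin_le_of_mem ?_
      exact Filter.mem_of_superset (Icc_mem_nhdsGE (hr.2.trans_le ht)) (Icc_subset_Icc_left hr0.1)
    exact (hcont.mono_left h1) (Metric.closedBall_mem_nhds _ hc)
  obtain ⟨q₀, hq₀, hq⟩ := (mem_nhdsGE_iff_exists_Ico_subset).1 hev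
  filter_upwards [Ico_mem_nhdsGE hq₀] with q hqm
  rcases hqm.1.eq_or_lt with rfl | hlt
  · simp
  obtain ⟨u, hu, huq⟩ := hx.mean r q hr0.1 hlt ((hq hqm).2.le.trans ht)
    (Metric.closedBall (f₁ r (x r)) c) Metric.isClosed_closedBall (convex_closedBall _ _)
    fun p hp => by
      have h1 := hneg p ⟨hr.1.trans_lt hp.1, hp.2.trans (hq hqm).2⟩
      exact ⟨fun _ => (hq ⟨hp.1.le, hp.2.trans hqm.2⟩).1, fun h0 => absurd h1 (not_lt.2 h0)⟩
  rw [huq, ← smul_sub, norm_smul, mul_comm]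
  exact mul_le_mul_of_nonneg_right (by simpa [dist_eq_norm] using hu) (norm_nonneg _)

theorem IsSwitchedCurve.isForwardSolution_right {T : ℝ} {Ω : Set E} {H : ℝ → E → ℝ}
    {f₁ f₂ : ℝ → E → E} {x : ℝ → E} (hx : IsSwitchedCurve T Ω H f₁ f₂ x)
    (hf : ContinuousOn (fun p : ℝ × E => f₂ p.1 p.2) (Icc 0 T ×ˢ Ω)) {s t : ℝ} (hs : 0 ≤ s)
    (ht : t ≤ T) (hpos : ∀ r ∈ Ioo s t, 0 < H r (x r)) : IsForwardSolution f₂ x s t :=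
  hx.symm.isForwardSolution_left hf hs ht fun r hr => neg_neg_of_pos (hpos r hr)

/-- A property that holds near the graph of `γ` holds in a tube of positive radius. -/
theorem exists_tube {E : Type*} [NormedAddCommGroup E] {γ : ℝ → E} {a b : ℝ} (hγ : ContinuousOn γ (Icc a b)) {P : ℝ → E → Prop}
    (hP : ∀ t ∈ Icc a b, ∀ᶠ p : ℝ × E in 𝓝[Icc a b ×ˢ univ] (t, γ t), P p.1 p.2) :
    ∃ η > 0, ∀ t ∈ Icc a b, ∀ x, ‖x - γ t‖ ≤ η → P t x := by
  -- The shift `x = γ t + u` turns the tube into a neighbourhood of `0`, uniform in `t` by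
  -- compactness. The repeated membership turns the relative neighbourhoods in `hP` into full ones.
  have key : ∀ᶠ u in 𝓝 (0 : E), ∀ t ∈ Icc a b, t ∈ Icc a b → P t (γ t + u) := by
    refine isCompact_Icc.eventually_forall_of_forall_eventually
      (P := fun u t => t ∈ Icc a b → P t (γ t + u)) fun t ht => ?_
    have hmem : ∀ᶠ z : E × ℝ in 𝓝[univ ×ˢ Icc a b] ((0 : E), t), P z.2 (γ z.2 + z.1) := by
      have htend : Tendsto (fun z : E × ℝ => (z.2, γ z.2 + z.1)) (𝓝[univ ×ˢ Icc a b] ((0 : E), t))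
          (𝓝[Icc a b ×ˢ univ] (t, γ t)) := by
        refine tendsto_nhdsWithin_iff.2 ⟨?_, ?_⟩
        · have h1 : ContinuousWithinAt (fun z : E × ℝ => (z.2, γ z.2 + z.1)) (univ ×ˢ Icc a b)
              ((0 : E), t) := by
            refine continuousWithinAt_snd.prodMk (ContinuousWithinAt.add ?_ continuousWithinAt_fst)
            exact (hγ t ht).comp continuousWithinAt_snd fun z hz => hz.2
          simpa [ContinuousWithinAt] using h1
        · filter_upwards [self_mem_nhdsWithin] with z hz
          exact ⟨hz.2, mem_univ _⟩
      exact htend.eventually (hP t ht)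
    filter_upwards [eventually_nhdsWithin_iff.1 hmem] with z hz hz2
    exact hz ⟨mem_univ _, hz2⟩
  obtain ⟨η, hη, hη'⟩ := Metric.nhds_basis_closedBall.eventually_iff.1 key
  refine ⟨η, hη, fun t ht x hx => ?_⟩
  have := hη' (x := x - γ t) (by simpa using hx) t ht ht
  simpa using this

end Curves

/-! ### Filippov solutions, and perturbation of a reference solution of a smooth field. -/

section Fields

variable {d : ℕ}

/-- The mean velocity is the average of `g`, and `g` lies almost everywhere in any closed convex `C`
as required; averages stay in such a set. This discards the measure theory for the rest of the
proof. -/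
theorem IsFilippovSolution.isSwitchedCurve {T : ℝ} {Ω : Set (Space d)} {H : ℝ → Space d → ℝ}
    {v f₁ f₂ : ℝ → Space d → Space d} {y : Space d} {x : ℝ → Space d}
    (hv : IsSwitchedField T Ω H v f₁ f₂) (hx : IsFilippovSolution T Ω H v f₁ f₂ y x) (hT : 0 ≤ T) :
    IsSwitchedCurve T Ω H f₁ f₂ x := by
  obtain ⟨hmem, g, hg, hint, hae⟩ := hx
  refine ⟨hmem, ?_, fun s t hs hst ht C hC hC' hCf => ?_⟩
  · have h1 : ContinuousOn (fun t => y + ∫ s in (0 : ℝ)..t, g s) (Icc 0 T) := by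
      refine continuousOn_const.add ?_
      have := intervalIntegral.continuousOn_primitive_interval' hg left_mem_uIcc
      rwa [uIcc_of_le hT] at this
    exact h1.congr hint
  · have h0s : IntervalIntegrable g volume 0 s := hg.mono_set (by
      rw [uIcc_of_le hs, uIcc_of_le hT]; exact Icc_subset_Icc_right (hst.le.trans ht))
    have h0t : IntervalIntegrable g volume 0 t := hg.mono_set (by
      rw [uIcc_of_le (hs.trans hst.le), uIcc_of_le hT]; exact Icc_subset_Icc_right ht)
    have hdiff : x t - x s = ∫ r in s..t, g r := by
      rw [hint t ⟨hs.trans hst.le, ht⟩, hint s ⟨hs, hst.le.trans ht⟩, add_sub_add_left_eq_sub,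
        intervalIntegral.integral_interval_sub_left h0t h0s]
    refine ⟨⨍ r in s..t, g r, ?_, ?_⟩
    · rw [uIoc_of_le hst.le]
      refine hC'.set_average_mem hC ?_ (by simp) ?_ ?_
      · simp [hst]
      · rw [← Measure.restrict_congr_set (Ioo_ae_eq_Ioc (μ := volume) (a := s) (b := t))]
        have hsub : Ioo s t ⊆ Icc 0 T := fun r hr => ⟨hs.trans hr.1.le, hr.2.le.trans ht⟩
        filter_upwards [ae_restrict_of_ae_restrict_of_subset hsub hae,
          ae_restrict_mem measurableSet_Ioo] with r hr hrm
        unfold filippovSet at hr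
        have hC2 := hCf r hrm
        have hrT := hsub hrm
        split_ifs at hr with h0
        · exact hC'.segment_subset (hC2.1 h0.le) (hC2.2 h0.ge) hr
        · rw [mem_singleton_iff.1 hr]
          rcases lt_or_gt_of_ne h0 with h0 | h0
          · rw [hv.eq_left r hrT _ (hmem r hrT) h0]; exact hC2.1 h0.le
          · rw [hv.eq_right r hrT _ (hmem r hrT) h0]; exact hC2.2 h0.le
      · exact (intervalIntegrable_iff_integrableOn_Ioc_of_le hst.le).1
          (h0s.symm.trans h0t)
    · rw [interval_average_eq, smul_smul, mul_inv_cancel₀ (sub_ne_zero.2 hst.ne'), one_smul, hdiff]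

variable {T : ℝ} {Ω : Set (Space d)} {f : ℝ → Space d → Space d} {γ : ℝ → Space d} {a b : ℝ}

/-- Joint continuity of the Jacobian and compactness of the graph of `γ` give a tube on which the
Jacobian varies by at most `ε`; the mean value inequality on each ball then bounds the remainder. -/
theorem IsC1Field.exists_taylor_tube (hΩ : IsOpen Ω) (hf : IsC1Field T Ω f)
    (hab : Icc a b ⊆ Icc 0 T) (hγ : ContinuousOn γ (Icc a b)) (hγΩ : ∀ t ∈ Icc a b, γ t ∈ Ω)
    {ε : ℝ} (hε : 0 < ε) :
    ∃ η > 0, ∀ t ∈ Icc a b, ∀ x, ‖x - γ t‖ ≤ η → x ∈ Ω ∧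
      ‖f t x - f t (γ t) - fderiv ℝ (f t) (γ t) (x - γ t)‖ ≤ ε * ‖x - γ t‖ := by
  obtain ⟨η, hη, h⟩ := exists_tube (P := fun t x => x ∈ Ω ∧
      ‖fderiv ℝ (f t) x - fderiv ℝ (f t) (γ t)‖ ≤ ε) hγ fun t ht => by
    have hΩt : ∀ᶠ p : ℝ × Space d in 𝓝[Icc a b ×ˢ univ] (t, γ t), p.2 ∈ Ω :=
      nhdsWithin_le_nhds (continuous_snd.continuousAt.eventually (hΩ.mem_nhds (hγΩ t ht)))
    have hmem : ∀ᶠ p : ℝ × Space d in 𝓝[Icc a b ×ˢ univ] (t, γ t), p.1 ∈ Icc a b := by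
      filter_upwards [self_mem_nhdsWithin] with p hp using hp.1
    have h1 : Tendsto (fun p : ℝ × Space d => fderiv ℝ (f p.1) p.2) (𝓝[Icc a b ×ˢ univ] (t, γ t))
        (𝓝 (fderiv ℝ (f t) (γ t))) := by
      refine (hf.continuousOn_fderiv (t, γ t) ⟨hab ht, hγΩ t ht⟩).tendsto.mono_left ?_
      refine le_inf nhdsWithin_le_nhds ?_
      rw [le_principal_iff]
      filter_upwards [hΩt, hmem] with p h1 h2 using ⟨hab h2, h1⟩
    have h2 : Tendsto (fun p : ℝ × Space d => fderiv ℝ (f p.1) (γ p.1))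
        (𝓝[Icc a b ×ˢ univ] (t, γ t)) (𝓝 (fderiv ℝ (f t) (γ t))) := by
      have : ContinuousOn (fun t => fderiv ℝ (f t) (γ t)) (Icc a b) :=
        hf.continuousOn_fderiv.comp (continuousOn_id.prodMk hγ) fun t ht => ⟨hab ht, hγΩ t ht⟩
      exact (this t ht).tendsto.comp (tendsto_nhdsWithin_iff.2
        ⟨(continuous_fst.tendsto (t, γ t)).mono_left nhdsWithin_le_nhds, hmem⟩)
    have h3 := (h1.sub h2).norm
    rw [sub_self, norm_zero] at h3
    filter_upwards [hΩt, h3.eventually_le_const hε] with p hp1 hp2 using ⟨hp1, hp2⟩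
  refine ⟨η, hη, fun t ht x hx => ⟨(h t ht x hx).1, ?_⟩⟩
  refine (convex_closedBall (γ t) η).norm_image_sub_le_of_norm_hasFDerivWithin_le'
    (f' := fun x => fderiv ℝ (f t) x) (fun z hz => ?_) (fun z hz => ?_)
    (Metric.mem_closedBall_self hη.le) (by simpa [dist_eq_norm] using hx)
  · have hz' : ‖z - γ t‖ ≤ η := by simpa [dist_eq_norm] using hz
    exact (hf.differentiableAt t (hab ht) z (h t ht z hz').1).hasFDerivAt.hasFDerivWithinAt
  · exact (h t ht z (by simpa [dist_eq_norm] using hz)).2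

theorem IsC1Field.continuousOn_fderiv_comp (hf : IsC1Field T Ω f)
    (hab : Icc a b ⊆ Icc 0 T) (hγ : ContinuousOn γ (Icc a b)) (hγΩ : ∀ t ∈ Icc a b, γ t ∈ Ω) :
    ContinuousOn (fun t => fderiv ℝ (f t) (γ t)) (Icc a b) :=
  hf.continuousOn_fderiv.comp (continuousOn_id.prodMk hγ) fun t ht => ⟨hab ht, hγΩ t ht⟩

/-- Forward solutions close to `γ` depend on their initial value in a Lipschitz way. -/
theorem IsC1Field.exists_lipschitz_tube (hΩ : IsOpen Ω) (hf : IsC1Field T Ω f)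
    (hab : Icc a b ⊆ Icc 0 T) (hγ : ContinuousOn γ (Icc a b)) (hγΩ : ∀ t ∈ Icc a b, γ t ∈ Ω) :
    ∃ η > 0, ∃ C > 0, ∀ s t x, a ≤ s → t ≤ b → IsForwardSolution f x s t →
      IsForwardSolution f γ s t → (∀ r ∈ Ico s t, ‖x r - γ r‖ ≤ η) →
      ∀ r ∈ Icc s t, ‖x r - γ r‖ ≤ C * ‖x s - γ s‖ := by
  obtain ⟨η, hη, h⟩ := hf.exists_taylor_tube hΩ hab hγ hγΩ one_pos
  obtain ⟨K, hK⟩ := isCompact_Icc.exists_bound_of_continuousOn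
    (hf.continuousOn_fderiv_comp hab hγ hγΩ)
  refine ⟨η, hη, Real.exp ((|K| + 1) * (b - a)), Real.exp_pos _,
    fun s t x hs ht hx hγs hclose r hr => ?_⟩
  have h1 := norm_le_of_almost_linear (A := fun t => fderiv ℝ (f t) (γ t)) (K := |K|) (ε := 1)
    (hx.continuousOn.sub hγs.continuousOn)
    (fun r hr => (hx.hasDeriv r hr).sub (hγs.hasDeriv r hr))
    (fun r hr => (hK r ⟨hs.trans hr.1, hr.2.le.trans ht⟩).trans (le_abs_self K))
    (fun r hr => (h r ⟨hs.trans hr.1, hr.2.le.trans ht⟩ (x r) (hclose r hr)).2) r hr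
  simp only [Pi.sub_apply] at h1
  rw [mul_comm]
  refine h1.trans (mul_le_mul_of_nonneg_left (Real.exp_le_exp.2 ?_) (norm_nonneg _))
  exact mul_le_mul_of_nonneg_left (by linarith [hr.2]) (by positivity)

/-- Forward solutions close to `γ` are described to first order by the variational equation. -/
theorem IsC1Field.exists_linear_tube (hΩ : IsOpen Ω) (hf : IsC1Field T Ω f)
    (hab : Icc a b ⊆ Icc 0 T) (hγ : ContinuousOn γ (Icc a b)) (hγΩ : ∀ t ∈ Icc a b, γ t ∈ Ω) :
    ∃ C > 0, ∀ ε > 0, ∃ η > 0, ∀ s t x, ∀ Φ : ℝ → Space d →L[ℝ] Space d, ∀ ξ M,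
      a ≤ s → s ≤ t → t ≤ b → IsForwardSolution f x s t → IsForwardSolution f γ s t →
      ContinuousOn Φ (Icc s t) →
      (∀ r ∈ Ico s t, HasDerivWithinAt Φ (fderiv ℝ (f r) (γ r) * Φ r) (Ici r) r) →
      (∀ r ∈ Ico s t, ‖x r - γ r‖ ≤ M) → 0 ≤ M → M ≤ η →
      ‖x t - γ t - Φ t ξ‖ ≤ C * ‖x s - γ s - Φ s ξ‖ + ε * M := by
  obtain ⟨K, hK⟩ := isCompact_Icc.exists_bound_of_continuousOn
    (hf.continuousOn_fderiv_comp hab hγ hγΩ)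
  set C := Real.exp ((|K| + 1) * (b - a)) with hC
  have hC0 : 0 < C := Real.exp_pos _
  refine ⟨C, hC0, fun ε hε => ?_⟩
  -- The Grönwall factor `C` does not depend on `ε`; dividing by it in advance leaves a final error
  -- of `ε * M`.
  obtain ⟨η, hη, h⟩ := hf.exists_taylor_tube hΩ hab hγ hγΩ (ε := ε / C) (by positivity)
  refine ⟨η, hη, fun s t x Φ ξ M hs hst ht hx hγs hΦc hΦ hclose hM0 hMη => ?_⟩
  have h1 := norm_sub_le_of_almost_linear (A := fun t => fderiv ℝ (f t) (γ t)) (K := |K| + 1)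
    (ε := ε / C) (M := M) (z := fun r => Φ r ξ) (by simp) (by positivity)
    (hx.continuousOn.sub hγs.continuousOn)
    (fun r hr => (hx.hasDeriv r hr).sub (hγs.hasDeriv r hr))
    (hΦc.clm_apply continuousOn_const)
    (fun r hr => by simpa using (hΦ r hr).clm_apply (hasDerivWithinAt_const r (Ici r) ξ))
    (fun r hr => (hK r ⟨hs.trans hr.1, hr.2.le.trans ht⟩).trans (by linarith [le_abs_self K]))
    hclose hM0
    (fun r hr => (h r ⟨hs.trans hr.1, hr.2.le.trans ht⟩ (x r) ((hclose r hr).trans hMη)).2)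
    t (right_mem_Icc.2 hst)
  simp only [Pi.sub_apply] at h1
  refine h1.trans ?_
  have h2 : Real.exp ((|K| + 1) * (t - s)) ≤ C :=
    Real.exp_le_exp.2 (mul_le_mul_of_nonneg_left (by linarith) (by positivity))
  have h3 := mul_le_mul_of_nonneg_left h2
    (show 0 ≤ ‖x s - γ s - Φ s ξ‖ + ε / C * M by positivity)
  refine h3.trans (le_of_eq ?_)
  field_simp

end Fields

/-! ### Local analysis at a transversal point of the switching boundary. -/

section Crossing

theorem eventually_box {E : Type*} [NormedAddCommGroup E] {t₁ : ℝ} {x₁ : E} {P : ℝ → E → Prop}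
    (h : ∀ᶠ p : ℝ × E in 𝓝 (t₁, x₁), P p.1 p.2) :
    ∀ᶠ η in 𝓝[>] (0 : ℝ), ∀ t x, |t - t₁| ≤ η → ‖x - x₁‖ ≤ η → P t x := by
  obtain ⟨η, hη, h⟩ := Metric.nhds_basis_closedBall.eventually_iff.1 h
  filter_upwards [Ioc_mem_nhdsGT hη] with r hr t x ht hx
  refine h (x := (t, x)) ?_
  rw [Metric.mem_closedBall, Prod.dist_eq, max_le_iff, Real.dist_eq, dist_eq_norm]
  exact ⟨ht.trans hr.2, hx.trans hr.2⟩

/-- Strict differentiability is needed because `H` is compared at pairs of points neither of which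
has to be the base point, such as points of two different curves. -/
theorem eventually_strict_box {E : Type*} [NormedAddCommGroup E] [NormedSpace ℝ E]
    {H : ℝ → E → ℝ} {DH : ℝ × E →L[ℝ] ℝ} {t₁ : ℝ} {x₁ : E}
    (h : HasStrictFDerivAt (fun p : ℝ × E => H p.1 p.2) DH (t₁, x₁)) {ε : ℝ} (hε : 0 < ε) :
    ∀ᶠ η in 𝓝[>] (0 : ℝ), ∀ s t x y, |s - t₁| ≤ η → |t - t₁| ≤ η → ‖x - x₁‖ ≤ η → ‖y - x₁‖ ≤ η →
      |H t x - H s y - DH (t - s, x - y)| ≤ ε * (|t - s| + ‖x - y‖) := by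
  have h1 := h.isLittleO.def hε
  obtain ⟨η, hη, h1⟩ := Metric.nhds_basis_closedBall.eventually_iff.1 h1
  filter_upwards [Ioc_mem_nhdsGT hη] with r hr s t x y hs ht hx hy
  have h2 := h1 (x := ((t, x), (s, y))) (by
    simp only [Metric.mem_closedBall, Prod.dist_eq, max_le_iff]
    rw [Real.dist_eq, Real.dist_eq, dist_eq_norm, dist_eq_norm]
    exact ⟨⟨ht.trans hr.2, hx.trans hr.2⟩, hs.trans hr.2, hy.trans hr.2⟩)
  refine h2.trans (mul_le_mul_of_nonneg_left ?_ hε.le)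
  rw [Prod.norm_def]
  exact max_le (le_add_of_nonneg_right (norm_nonneg _)) (le_add_of_nonneg_left (abs_nonneg _))

variable {d : ℕ} {T : ℝ} {Ω : Set (Space d)} {H : ℝ → Space d → ℝ}
  {f₁ f₂ : ℝ → Space d → Space d} {t₁ : ℝ} {x₁ : Space d} {DH : ℝ × Space d →L[ℝ] ℝ}

/-- Regularity and transversality, in the upward direction, of a switched system at `(t₁, x₁)`. -/
structure IsTransversalAt (T : ℝ) (Ω : Set (Space d)) (H : ℝ → Space d → ℝ)
    (f₁ f₂ : ℝ → Space d → Space d) (t₁ : ℝ) (x₁ : Space d) (DH : ℝ × Space d →L[ℝ] ℝ) :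
    Prop where
  isOpen : IsOpen Ω
  time_mem : t₁ ∈ Ioo 0 T
  mem : x₁ ∈ Ω
  left_field : IsC1Field T Ω f₁
  right_field : IsC1Field T Ω f₂
  continuousOn : ContinuousOn (fun p : ℝ × Space d => H p.1 p.2) (Icc 0 T ×ˢ Ω)
  hasStrictFDerivAt : HasStrictFDerivAt (fun p : ℝ × Space d => H p.1 p.2) DH (t₁, x₁)
  eq_zero : H t₁ x₁ = 0
  left_rate : 0 < DH (1, f₁ t₁ x₁)
  right_rate : 0 < DH (1, f₂ t₁ x₁)

namespace IsTransversalAt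

variable (h : IsTransversalAt T Ω H f₁ f₂ t₁ x₁ DH)

include h

theorem nhds_mem : Icc 0 T ×ˢ Ω ∈ 𝓝 (t₁, x₁) :=
  prod_mem_nhds (Icc_mem_nhds h.time_mem.1 h.time_mem.2) (h.isOpen.mem_nhds h.mem)

theorem eventually_Icc_subset :
    ∀ᶠ η in 𝓝[>] (0 : ℝ), Icc (t₁ - η) (t₁ + η) ⊆ Icc 0 T := by
  filter_upwards [Ioc_mem_nhdsGT h.time_mem.1, Ioc_mem_nhdsGT (sub_pos.2 h.time_mem.2)]
    with η h1 h2 using Icc_subset_Icc (by linarith [h1.2]) (by linarith [h2.2])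

/-- Near the crossing point, `H` increases along all curves at a positive rate, and the speed of
all curves is bounded. -/
theorem exists_rate : ∃ κ > 0, ∃ V > 0, ∀ᶠ η in 𝓝[>] (0 : ℝ), ∀ x, IsSwitchedCurve T Ω H f₁ f₂ x →
    ∀ s t, t₁ - η ≤ s → s ≤ t → t ≤ t₁ + η → (∀ r ∈ Ioo s t, ‖x r - x₁‖ ≤ η) →
    ‖x t - x s‖ ≤ V * (t - s) ∧ (‖x s - x₁‖ ≤ η → ‖x t - x₁‖ ≤ η →
      κ * (t - s) ≤ H t (x t) - H s (x s)) := by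
  set m := min (DH (1, f₁ t₁ x₁)) (DH (1, f₂ t₁ x₁)) with hm
  have hm0 : 0 < m := lt_min h.left_rate h.right_rate
  set V := ‖f₁ t₁ x₁‖ + ‖f₂ t₁ x₁‖ + 1 with hV
  have hV0 : 0 < V := by positivity
  -- `C` is open, so both fields remain in it near the crossing point; `C'` is closed, convex and
  -- contains `C`, so it captures mean velocities. The affine condition on `DH (1, u)` is rewritten
  -- with the linear `DH (0, u)` to exhibit a half-space.
  set C : Set (Space d) := {u | ‖u‖ < V} ∩ {u | m / 2 < DH (1, u)}
  set C' : Set (Space d) := Metric.closedBall 0 V ∩ {u | DH (0, u) ≥ m / 2 - DH (1, 0)} with hC'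
  have hsplit : ∀ u, DH (1, u) = DH (1, 0) + DH (0, u) := fun u => by
    rw [← map_add]; simp
  have hsub : C ⊆ C' := fun u hu => by
    refine ⟨by simpa using hu.1.le, ?_⟩
    have : m / 2 < DH (1, u) := hu.2
    rw [hsplit] at this
    show DH (0, u) ≥ _
    linarith
  have hCo : IsOpen C := by
    refine (isOpen_lt continuous_norm continuous_const).inter (isOpen_lt continuous_const ?_)
    fun_prop
  have hCc : IsClosed C' := by
    refine Metric.isClosed_closedBall.inter (isClosed_le continuous_const ?_)
    fun_prop
  have hCv : Convex ℝ C' := by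
    refine (convex_closedBall _ _).inter (convex_halfSpace_ge ?_ _)
    exact (DH.comp (ContinuousLinearMap.inr ℝ ℝ (Space d))).toLinearMap.isLinear
  have e1 : ∀ᶠ p : ℝ × Space d in 𝓝 (t₁, x₁), f₁ p.1 p.2 ∈ C :=
    (h.left_field.continuousOn.continuousAt h.nhds_mem).eventually (hCo.mem_nhds
      ⟨show _ < V by rw [hV]; linarith [norm_nonneg (f₂ t₁ x₁)], by
        have := min_le_left (DH (1, f₁ t₁ x₁)) (DH (1, f₂ t₁ x₁)); show m / 2 < _; linarith⟩)
  have e2 : ∀ᶠ p : ℝ × Space d in 𝓝 (t₁, x₁), f₂ p.1 p.2 ∈ C :=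
    (h.right_field.continuousOn.continuousAt h.nhds_mem).eventually (hCo.mem_nhds
      ⟨show _ < V by rw [hV]; linarith [norm_nonneg (f₁ t₁ x₁)], by
        have := min_le_right (DH (1, f₁ t₁ x₁)) (DH (1, f₂ t₁ x₁)); show m / 2 < _; linarith⟩)
  -- The linear part of `H` grows at rate at least `m / 2`; the differentiability error `m / (4 (1 +
  -- V))`, at speed at most `V`, costs at most `m / 4`.
  refine ⟨m / 4, by positivity, V, hV0, ?_⟩
  filter_upwards [h.eventually_Icc_subset, eventually_box (P := fun t x => f₁ t x ∈ C) e1,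
    eventually_box (P := fun t x => f₂ t x ∈ C) e2,
    eventually_strict_box h.hasStrictFDerivAt (ε := m / (4 * (1 + V))) (by positivity)]
    with η hT h1 h2 h3 x hx s t hs hst ht hbox
  rcases hst.eq_or_lt with rfl | hlt
  · simp
  have habs : ∀ r ∈ Icc s t, |r - t₁| ≤ η := fun r hr =>
    abs_sub_le_iff.2 ⟨by linarith [hr.2], by linarith [hr.1]⟩
  have hsT := hT ⟨hs, hst.trans ht⟩
  have htT := hT ⟨hs.trans hst, ht⟩
  obtain ⟨u, hu, hue⟩ := hx.mean s t hsT.1 hlt htT.2 C' hCc hCv fun r hr =>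
    ⟨fun _ => hsub (h1 r _ (habs r (Ioo_subset_Icc_self hr)) (hbox r hr)),
      fun _ => hsub (h2 r _ (habs r (Ioo_subset_Icc_self hr)) (hbox r hr))⟩
  have huV : ‖u‖ ≤ V := by simpa using hu.1
  have hum : m / 2 ≤ DH (1, u) := by
    have : DH (0, u) ≥ m / 2 - DH (1, 0) := hu.2
    rw [hsplit]; linarith
  have hts : 0 < t - s := sub_pos.2 hlt
  have hnorm : ‖x t - x s‖ ≤ V * (t - s) := by
    rw [hue, norm_smul, Real.norm_of_nonneg hts.le, mul_comm]
    exact mul_le_mul_of_nonneg_right huV hts.le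
  refine ⟨hnorm, fun hxs hxt => ?_⟩
  have h4 := h3 s t (x t) (x s) (habs s ⟨le_rfl, hst⟩) (habs t ⟨hst, le_rfl⟩) hxt hxs
  have h5 : DH (t - s, x t - x s) = (t - s) * DH (1, u) := by
    rw [hue, ← smul_eq_mul, ← map_smul]; simp
  rw [h5, abs_of_pos hts] at h4
  have h6 : m / (4 * (1 + V)) * (t - s + ‖x t - x s‖) ≤ m / 4 * (t - s) := by
    calc _ ≤ m / (4 * (1 + V)) * (t - s + V * (t - s)) := by gcongr
      _ = _ := by field_simp
  have h7 := (abs_le.1 h4).1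
  nlinarith

/-- The jump of the difference of two curves, `p` crossing at time `a` and `q` at time `b`. -/
theorem eventually_jump {ε : ℝ} (hε : 0 < ε) :
    ∀ᶠ η in 𝓝[>] (0 : ℝ), ∀ p q, IsSwitchedCurve T Ω H f₁ f₂ p → IsSwitchedCurve T Ω H f₁ f₂ q →
    ∀ a b, t₁ - η ≤ a → a ≤ b → b ≤ t₁ + η →
    (∀ r ∈ Icc a b, ‖p r - x₁‖ ≤ η) → (∀ r ∈ Icc a b, ‖q r - x₁‖ ≤ η) →
    H a (p a) = 0 → (∀ r ∈ Ioo a b, 0 < H r (p r)) →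
    H b (q b) = 0 → (∀ r ∈ Ioo a b, H r (q r) < 0) →
    ‖(p b - q b) - (p a - q a) - ((DH (1, f₁ t₁ x₁))⁻¹ * DH (0, p a - q a)) •
      (f₂ t₁ x₁ - f₁ t₁ x₁)‖ ≤ ε * ((b - a) + ‖p a - q a‖) := by
  set vm := f₁ t₁ x₁ with hvm
  set vp := f₂ t₁ x₁ with hvp
  set c := DH (1, vm) with hc
  have hc0 : 0 < c := h.left_rate
  -- The `2` accounts for the errors of the two mean velocities, the rest for the error of the delay
  -- `b - a` multiplied by the velocity jump.
  set B := 2 + (2 + ‖vm‖ + ‖DH‖) * (c⁻¹ * ‖vp - vm‖) with hB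
  have hB0 : 0 < B := by positivity
  obtain ⟨e, he0, he1, heB⟩ : ∃ e > 0, e ≤ 1 ∧ e * B ≤ ε :=
    ⟨min 1 (ε / B), by positivity, min_le_left _ _, by
      calc _ ≤ ε / B * B := by gcongr; exact min_le_right _ _
        _ = ε := by field_simp⟩
  have e1 : ∀ᶠ p : ℝ × Space d in 𝓝 (t₁, x₁), f₁ p.1 p.2 ∈ Metric.closedBall vm e :=
    (h.left_field.continuousOn.continuousAt h.nhds_mem).eventually
      (Metric.closedBall_mem_nhds _ he0)
  have e2 : ∀ᶠ p : ℝ × Space d in 𝓝 (t₁, x₁), f₂ p.1 p.2 ∈ Metric.closedBall vp e :=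
    (h.right_field.continuousOn.continuousAt h.nhds_mem).eventually
      (Metric.closedBall_mem_nhds _ he0)
  filter_upwards [h.eventually_Icc_subset, 
    eventually_box (P := fun t x => f₁ t x ∈ Metric.closedBall vm e) e1,
    eventually_box (P := fun t x => f₂ t x ∈ Metric.closedBall vp e) e2,
    eventually_strict_box h.hasStrictFDerivAt he0]
    with η hT h1 h2 h3 p q hp hq a b ha hab hb hpb hqb hpa hpos hqb0 hneg
  have habs : ∀ r ∈ Icc a b, |r - t₁| ≤ η := fun r hr =>
    abs_sub_le_iff.2 ⟨by linarith [hr.2], by linarith [hr.1]⟩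
  have haT := hT ⟨ha, hab.trans hb⟩
  have hbT := hT ⟨ha.trans hab, hb⟩
  obtain ⟨u₁, u₂, hu₁, hu₂, hq1, hp1⟩ : ∃ u₁ u₂ : Space d, ‖u₁ - vm‖ ≤ e ∧ ‖u₂ - vp‖ ≤ e ∧
      q b - q a = (b - a) • u₁ ∧ p b - p a = (b - a) • u₂ := by
    rcases hab.eq_or_lt with rfl | hlt
    · exact ⟨vm, vp, by simpa using he0.le, by simpa using he0.le, by simp, by simp⟩
    obtain ⟨u₁, hu₁, hq1⟩ := hq.mean a b haT.1 hlt hbT.2 _ Metric.isClosed_closedBall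
      (convex_closedBall vm e) fun r hr =>
      ⟨fun _ => h1 r _ (habs r (Ioo_subset_Icc_self hr)) (hqb r (Ioo_subset_Icc_self hr)),
        fun h0 => absurd (hneg r hr) (not_lt.2 h0)⟩
    obtain ⟨u₂, hu₂, hp1⟩ := hp.mean a b haT.1 hlt hbT.2 _ Metric.isClosed_closedBall
      (convex_closedBall vp e) fun r hr =>
      ⟨fun h0 => absurd (hpos r hr) (not_lt.2 h0),
        fun _ => h2 r _ (habs r (Ioo_subset_Icc_self hr)) (hpb r (Ioo_subset_Icc_self hr))⟩
    exact ⟨u₁, u₂, by simpa [dist_eq_norm] using hu₁, by simpa [dist_eq_norm] using hu₂, hq1, hp1⟩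
  have hba : 0 ≤ b - a := sub_nonneg.2 hab
  have ma : a ∈ Icc a b := ⟨le_rfl, hab⟩
  have mb : b ∈ Icc a b := ⟨hab, le_rfl⟩
  have k1 := h3 a b (q b) (q a) (habs a ma) (habs b mb) (hqb b mb) (hqb a ma)
  have k2 := h3 a a (p a) (q a) (habs a ma) (habs a ma) (hpb a ma) (hqb a ma)
  have hu₁n : ‖u₁‖ ≤ ‖vm‖ + 1 := by
    have := norm_le_norm_add_norm_sub' u₁ vm; linarith
  have k3 : DH (b - a, q b - q a) = (b - a) * c + (b - a) * DH (0, u₁ - vm) := by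
    rw [hq1, ← mul_add, hc, ← map_add, ← smul_eq_mul, ← map_smul]; simp
  have k4 : |DH (0, u₁ - vm)| ≤ ‖DH‖ * e := by
    refine (DH.le_opNorm _).trans (mul_le_mul_of_nonneg_left ?_ (norm_nonneg _))
    rw [Prod.norm_def]
    exact max_le (by simpa using he0.le) hu₁
  have k5 : ‖q b - q a‖ ≤ (b - a) * (‖vm‖ + 1) := by
    rw [hq1, norm_smul, Real.norm_of_nonneg hba]
    exact mul_le_mul_of_nonneg_left hu₁n hba
  rw [hqb0, k3, abs_of_nonneg hba] at k1
  rw [hpa, sub_self, abs_zero, zero_add] at k2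
  set D := DH (0, p a - q a) with hD
  -- First-order formula for the delay: `H a (q a)` is about `-D` because `H a (p a) = 0`, and about
  -- `-(b - a) * c` because `H b (q b) = 0`.
  have k6 : |D - (b - a) * c| ≤ e * (2 + ‖vm‖ + ‖DH‖) * ((b - a) + ‖p a - q a‖) := by
    have k7 : |(b - a) * DH (0, u₁ - vm)| ≤ (b - a) * (‖DH‖ * e) := by
      rw [abs_mul, abs_of_nonneg hba]; gcongr
    have k8 : e * (b - a + ‖q b - q a‖) ≤ e * (b - a + (b - a) * (‖vm‖ + 1)) := by gcongr
    have n0 : 0 ≤ e * (1 + ‖vm‖ + ‖DH‖) * ‖p a - q a‖ := by positivity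
    obtain ⟨k1l, k1u⟩ := abs_le.1 k1
    obtain ⟨k2l, k2u⟩ := abs_le.1 k2
    obtain ⟨k7l, k7u⟩ := abs_le.1 k7
    exact abs_le.2 ⟨by linarith, by linarith⟩
  have key : (p b - q b) - (p a - q a) - (c⁻¹ * D) • (vp - vm) =
      (b - a) • ((u₂ - vp) - (u₁ - vm)) - (c⁻¹ * (D - (b - a) * c)) • (vp - vm) := by
    have : (p b - q b) - (p a - q a) = (b - a) • u₂ - (b - a) • u₁ := by
      rw [← hp1, ← hq1]; abel
    have hcc : c⁻¹ * (D - (b - a) * c) = c⁻¹ * D - (b - a) := by field_simp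
    rw [this, hcc]; module
  rw [key]
  calc _ ≤ ‖(b - a) • ((u₂ - vp) - (u₁ - vm))‖ + ‖(c⁻¹ * (D - (b - a) * c)) • (vp - vm)‖ :=
        norm_sub_le _ _
    _ ≤ (b - a) * (e + e) + (c⁻¹ * (e * (2 + ‖vm‖ + ‖DH‖) * ((b - a) + ‖p a - q a‖))) *
          ‖vp - vm‖ := by
        rw [norm_smul, norm_smul, Real.norm_of_nonneg hba, norm_mul, Real.norm_eq_abs c⁻¹,
          abs_of_pos (inv_pos.2 hc0), Real.norm_eq_abs]
        gcongr
        exact (norm_sub_le _ _).trans (add_le_add hu₂ hu₁)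
    _ ≤ e * B * ((b - a) + ‖p a - q a‖) := by
        have : 0 ≤ e * ‖p a - q a‖ := by positivity
        rw [hB]; linarith
    _ ≤ _ := by gcongr

end IsTransversalAt

end Crossing

/-! ### Unique crossing of nearby curves, with Lipschitz bounds. -/

section Crossing

variable {d : ℕ} {T : ℝ} {Ω : Set (Space d)} {H : ℝ → Space d → ℝ}
  {f₁ f₂ : ℝ → Space d → Space d} {t₁ : ℝ} {DH : ℝ × Space d →L[ℝ] ℝ}

/-- On `[0, t₂]` the curve `x` crosses `H = 0` upwards, exactly once, at time `τ`, and both `τ` and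
`x` are within `M` of `t₁` and of the reference curve `γ`. -/
structure CrossesNear (H : ℝ → Space d → ℝ) (x γ : ℝ → Space d) (t₁ t₂ M τ : ℝ) : Prop where
  time_mem : τ ∈ Ioo 0 t₂
  neg : ∀ t ∈ Ico 0 τ, H t (x t) < 0
  eq_zero : H τ (x τ) = 0
  pos : ∀ t ∈ Ioc τ t₂, 0 < H t (x t)
  time_le : |τ - t₁| ≤ M
  dist_le : ∀ t ∈ Icc 0 t₂, ‖x t - γ t‖ ≤ M

/-- As long as the reference curve stays in `H < 0`, so do its neighbours, and they depend on the
initial value in a Lipschitz way. -/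
theorem eventually_neg_of_neg {φ : ℝ → Space d → Space d} {x₀ : Space d}
    (hf : IsC1Field T Ω f₁)
    (hH : ContinuousOn (fun p : ℝ × Space d => H p.1 p.2) (Icc 0 T ×ˢ Ω))
    (hφ : ∀ᶠ y in 𝓝 x₀, IsSwitchedCurve T Ω H f₁ f₂ (fun t => φ t y) ∧ φ 0 y = y)
    {η C : ℝ} (hη : 0 < η)
    (htube : ∀ s t x, 0 ≤ s → t ≤ T → IsForwardSolution f₁ x s t →
      IsForwardSolution f₁ (fun t => φ t x₀) s t → (∀ r ∈ Ico s t, ‖x r - φ r x₀‖ ≤ η) →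
      ∀ r ∈ Icc s t, ‖x r - φ r x₀‖ ≤ C * ‖x s - φ s x₀‖)
    {a : ℝ} (ha : a ≤ T) (hneg : ∀ t ∈ Icc 0 a, H t (φ t x₀) < 0) :
    ∀ᶠ y in 𝓝 x₀, ∀ t ∈ Icc 0 a,
      H t (φ t y) < 0 ∧ ‖φ t y - φ t x₀‖ ≤ η ∧ ‖φ t y - φ t x₀‖ ≤ C * ‖y - x₀‖ := by
  obtain ⟨hγ, hγ0⟩ := hφ.self_of_nhds
  have hsub : Icc 0 a ⊆ Icc 0 T := Icc_subset_Icc_right ha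
  obtain ⟨ρ, hρ, hρ'⟩ := exists_tube (P := fun t x => x ∈ Ω → H t x < 0)
    (hγ.continuousOn.mono hsub) fun t ht => by
      have h1 := (hH (t, φ t x₀) ⟨hsub ht, hγ.mem t (hsub ht)⟩).eventually_lt_const (hneg t ht)
      filter_upwards [nhdsWithin_le_nhds (eventually_nhdsWithin_iff.1 h1), self_mem_nhdsWithin]
        with p hp1 hp2 hp3 using hp1 ⟨hsub hp2.1, hp3⟩
  have hδ : ∀ᶠ y in 𝓝 x₀, C * ‖y - x₀‖ < min ρ η := by
    have : Tendsto (fun y => C * ‖y - x₀‖) (𝓝 x₀) (𝓝 (C * ‖x₀ - x₀‖)) :=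
      Continuous.tendsto (by fun_prop) x₀
    rw [sub_self, norm_zero, mul_zero] at this
    exact this.eventually_lt_const (lt_min hρ hη)
  filter_upwards [hφ, hδ] with y ⟨hy, hy0⟩ hyδ
  -- Bootstrap: inside the `ρ`-tube the neighbour stays in `H < 0` and so solves the `f₁` equation;
  -- the resulting Lipschitz bound is smaller than the radius assumed.
  have step : ∀ t ∈ Icc 0 a, (∀ r ∈ Ico 0 t, ‖φ r y - φ r x₀‖ < min ρ η) →
      ‖φ t y - φ t x₀‖ ≤ C * ‖y - x₀‖ := fun t ht hr => by
    have h1 : ∀ r ∈ Ioo 0 t, H r (φ r y) < 0 := fun r hrt =>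
      hρ' r ⟨hrt.1.le, hrt.2.le.trans ht.2⟩ _
        ((hr r ⟨hrt.1.le, hrt.2⟩).le.trans (min_le_left _ _))
        (hy.mem r (hsub ⟨hrt.1.le, hrt.2.le.trans ht.2⟩))
    have h2 := htube 0 t (fun t => φ t y) le_rfl (ht.2.trans ha)
      (hy.isForwardSolution_left hf.continuousOn le_rfl (ht.2.trans ha) h1)
      (hγ.isForwardSolution_left hf.continuousOn le_rfl (ht.2.trans ha)
        fun r hr => hneg r ⟨hr.1.le, hr.2.le.trans ht.2⟩)
      (fun r hrt => (hr r hrt).le.trans (min_le_right _ _)) t ⟨ht.1, le_rfl⟩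
    simpa only [hy0, hγ0] using h2
  have hall := norm_lt_of_bootstrap (w := fun t => φ t y - φ t x₀) (R := min ρ η)
    ((hy.continuousOn.mono hsub).sub (hγ.continuousOn.mono hsub))
    fun t ht hr => (step t ht hr).trans_lt hyδ
  exact fun t ht => ⟨hρ' t ht _ ((hall t ht).le.trans (min_le_left _ _)) (hy.mem t (hsub ht)),
    (hall t ht).le.trans (min_le_right _ _),
    step t ht fun r hr => hall r ⟨hr.1, hr.2.le.trans ht.2⟩⟩

/-- All curves that start near `x₀` cross `H = 0` exactly once, at a time and along a path that
depend on the starting point in a Lipschitz way. -/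
theorem IsTransversalAt.exists_crossesNear {φ : ℝ → Space d → Space d} {x₀ : Space d}
    (h : IsTransversalAt T Ω H f₁ f₂ t₁ (φ t₁ x₀) DH)
    (hφ : ∀ᶠ y in 𝓝 x₀, IsSwitchedCurve T Ω H f₁ f₂ (fun t => φ t y) ∧ φ 0 y = y)
    (hneg : ∀ t ∈ Ico 0 t₁, H t (φ t x₀) < 0) :
    ∃ t₂ ∈ Ioc t₁ T, (∀ t ∈ Ioc t₁ t₂, 0 < H t (φ t x₀)) ∧ ∃ K > 0, ∀ᶠ y in 𝓝 x₀, ∃ τ,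
      CrossesNear H (fun t => φ t y) (fun t => φ t x₀) t₁ t₂ (K * ‖y - x₀‖) τ := by
  obtain ⟨hγ, hγ0⟩ := hφ.self_of_nhds
  set x₁ := φ t₁ x₀ with hx₁
  obtain ⟨ht0, htT⟩ := h.time_mem
  obtain ⟨η₁, hη₁, C₁, hC₁, htube₁⟩ := h.left_field.exists_lipschitz_tube h.isOpen subset_rfl
    hγ.continuousOn hγ.mem
  obtain ⟨η₂, hη₂, C₂, hC₂, htube₂⟩ := h.right_field.exists_lipschitz_tube h.isOpen subset_rfl
    hγ.continuousOn hγ.mem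
  obtain ⟨κ, hκ, V, hV, hrate⟩ := h.exists_rate
  -- Two points in the `η`-ball about `x₁` are at most `2 * η` apart, hence within both tube radii.
  have hsmall : ∀ᶠ η in 𝓝[>] (0 : ℝ), η ∈ Ioc 0 (min (η₁ / 2) (η₂ / 2)) :=
    Ioc_mem_nhdsGT (by positivity)
  obtain ⟨η, hrate, hstrict, hηT, hη, hη12⟩ := (hrate.and <|
    (eventually_strict_box h.hasStrictFDerivAt one_pos).and <|
    h.eventually_Icc_subset.and hsmall).exists
  have hη1 := hη12.trans (min_le_left _ _)
  have hη2 := hη12.trans (min_le_right _ _)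
  have hγc : ContinuousAt (fun t => φ t x₀) t₁ := hγ.continuousOn.continuousAt (Icc_mem_nhds ht0 htT)
  obtain ⟨σ₀, hσ₀, hσγ⟩ := Metric.continuousAt_iff.1 hγc (η / 4) (by positivity)
  -- The time window `|t - t₁| ≤ σ` is so short that a curve of speed at most `V` moves by at most
  -- `η / 4` across it and cannot leave the `η`-ball.
  obtain ⟨σ, hσ0, hσσ, hση, hσV⟩ : ∃ σ > 0, σ < σ₀ ∧ σ ≤ η ∧ V * (2 * σ) ≤ η / 4 := by
    refine ⟨min (σ₀ / 2) (min η (η / (8 * V))), by positivity, ?_, ?_, ?_⟩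
    · exact (min_le_left _ _).trans_lt (half_lt_self hσ₀)
    · exact (min_le_right _ _).trans (min_le_left _ _)
    · calc _ ≤ V * (2 * (η / (8 * V))) := by
            gcongr; exact (min_le_right _ _).trans (min_le_right _ _)
        _ = _ := by field_simp; norm_num
  have hγbox : ∀ r, t₁ - σ ≤ r → r ≤ t₁ + σ → ‖φ r x₀ - x₁‖ ≤ η / 4 := fun r h1 h2 => by
    have : dist r t₁ < σ₀ := by
      rw [Real.dist_eq]; exact (abs_sub_le_iff.2 ⟨by linarith, by linarith⟩).trans_lt hσσ
    exact (dist_eq_norm (φ r x₀) x₁ ▸ hσγ this).le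
  set t₂ := t₁ + σ with ht₂
  have hsub : Icc (t₁ - σ) t₂ ⊆ Icc 0 T :=
    (Icc_subset_Icc (by linarith) (by linarith)).trans hηT
  have ht₂T : t₂ ≤ T := (hsub ⟨by linarith, le_rfl⟩).2
  have hγmono : ∀ s t, t₁ - σ ≤ s → s ≤ t → t ≤ t₂ →
      κ * (t - s) ≤ H t (φ t x₀) - H s (φ s x₀) := fun s t hs hst ht =>
    (hrate _ hγ s t (by linarith) hst (by linarith) fun r hr => by
      linarith [hγbox r (by linarith [hr.1]) (by linarith [hr.2])]).2
      (by linarith [hγbox s hs (by linarith)]) (by linarith [hγbox t (by linarith) ht])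
  have hγpos : ∀ t ∈ Ioc t₁ t₂, 0 < H t (φ t x₀) := fun t ht => by
    have h1 := hγmono t₁ t (by linarith) ht.1.le ht.2
    have h2 := mul_pos hκ (sub_pos.2 ht.1)
    have h3 : H t₁ (φ t₁ x₀) = 0 := h.eq_zero
    linarith
  -- At time `a` the deficit of `H` is below `κ * σ`, which growth at rate `κ` makes up before `t₂ =
  -- t₁ + σ`, also for nearby curves.
  obtain ⟨a, haσ, hat, haH⟩ : ∃ a, t₁ - σ < a ∧ a < t₁ ∧ -(κ * σ) < H a (φ a x₀) := by
    have h1 : ContinuousAt (fun t => H t (φ t x₀)) t₁ :=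
      (hγ.continuousOn_comp h.continuousOn).continuousAt (Icc_mem_nhds ht0 htT)
    have h2 : ∀ᶠ t in 𝓝[<] t₁, -(κ * σ) < H t (φ t x₀) :=
      nhdsWithin_le_nhds (h1.eventually (lt_mem_nhds (by
        have h3 : H t₁ (φ t₁ x₀) = 0 := h.eq_zero
        have := mul_pos hκ hσ0
        linarith)))
    obtain ⟨a, h3, h4⟩ := (h2.and (Ioo_mem_nhdsLT (show t₁ - σ < t₁ by linarith))).exists
    exact ⟨a, h4.1, h4.2, h3⟩
  have ha0 : 0 ≤ a := (hsub ⟨haσ.le, by linarith⟩).1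
  set L := ‖DH‖ + 1 with hL
  have hL0 : 0 < L := by positivity
  have hlip : ∀ t x y, |t - t₁| ≤ η → ‖x - x₁‖ ≤ η → ‖y - x₁‖ ≤ η →
      |H t x - H t y| ≤ L * ‖x - y‖ := fun t x y ht hx hy => by
    have h1 := hstrict t t x y ht ht hx hy
    have h2 : |DH (t - t, x - y)| ≤ ‖DH‖ * ‖x - y‖ := by
      simpa [Prod.norm_def] using DH.le_opNorm (t - t, x - y)
    rw [sub_self, abs_zero, zero_add, one_mul] at h1
    rw [sub_self] at h2
    rw [abs_le] at h1 h2 ⊢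
    constructor <;> linarith [h1.1, h1.2, h2.1, h2.2]
  -- `K₁` bounds the difference of crossing times: the gap `L * C₁ * δ` in `H` closes at rate `κ`.
  -- In `K₂` the extra term is the motion of both curves, at speed at most `V`, during that delay.
  set K₁ := L * C₁ / κ with hK₁
  set K₂ := C₁ + 2 * V * K₁ with hK₂
  have hK₁0 : 0 < K₁ := by positivity
  have hK₂0 : 0 < K₂ := by positivity
  refine ⟨t₂, ⟨by linarith, ht₂T⟩, hγpos, K₁ + K₂ + C₂ * K₂, by positivity, ?_⟩
  have hδ : ∀ᶠ y in 𝓝 x₀, C₁ * ‖y - x₀‖ < η / 4 ∧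
      L * (C₁ * ‖y - x₀‖) < H a (φ a x₀) + κ * σ := by
    have e1 : Tendsto (fun y => C₁ * ‖y - x₀‖) (𝓝 x₀) (𝓝 (C₁ * ‖x₀ - x₀‖)) :=
      Continuous.tendsto (by fun_prop) x₀
    have e2 : Tendsto (fun y => L * (C₁ * ‖y - x₀‖)) (𝓝 x₀) (𝓝 (L * (C₁ * ‖x₀ - x₀‖))) :=
      Continuous.tendsto (by fun_prop) x₀
    rw [sub_self, norm_zero, mul_zero] at e1 e2
    rw [mul_zero] at e2
    exact (e1.eventually_lt_const (by positivity)).and (e2.eventually_lt_const (by linarith))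
  filter_upwards [hφ, hδ, eventually_neg_of_neg h.left_field h.continuousOn hφ hη₁ htube₁
    (by linarith : a ≤ T) fun t ht => hneg t ⟨ht.1, ht.2.trans_lt hat⟩] with y ⟨hy, hy0⟩ hyδ hypre
  set δ := ‖y - x₀‖ with hδdef
  have hδ0 : 0 ≤ δ := norm_nonneg _
  have hat₂ : a ≤ t₂ := by linarith
  have hIT : Icc a t₂ ⊆ Icc 0 T := (Icc_subset_Icc_left haσ.le).trans hsub
  have hya : ‖φ a y - φ a x₀‖ ≤ C₁ * δ := (hypre a ⟨ha0, le_rfl⟩).2.2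
  have hya1 : ‖φ a y - x₁‖ ≤ C₁ * δ + η / 4 := by
    have := norm_sub_le_norm_sub_add_norm_sub (φ a y) (φ a x₀) x₁
    linarith [hγbox a haσ.le (by linarith)]
  have hybox' : ∀ t ∈ Icc a t₂, ‖φ t y - x₁‖ < η := by
    refine norm_lt_of_bootstrap (w := fun t => φ t y - x₁)
      ((hy.continuousOn.mono hIT).sub continuousOn_const) fun t ht hr => ?_
    have h1 := (hrate _ hy a t (by linarith) ht.1 (by linarith [ht.2]) fun r hrt =>
      (hr r ⟨hrt.1.le, hrt.2⟩).le).1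
    have h2 := norm_sub_le_norm_sub_add_norm_sub (φ t y) (φ a y) x₁
    have h3 : V * (t - a) ≤ V * (2 * σ) := by gcongr; linarith [ht.2]
    linarith [hyδ.1]
  have hybox : ∀ t ∈ Icc a t₂, ‖φ t y - x₁‖ ≤ η := fun t ht => (hybox' t ht).le
  have hγbox' : ∀ t ∈ Icc a t₂, ‖φ t x₀ - x₁‖ ≤ η := fun t ht => by
    linarith [hγbox t (by linarith [ht.1]) ht.2]
  have hyrate : ∀ s t, a ≤ s → s ≤ t → t ≤ t₂ →
      κ * (t - s) ≤ H t (φ t y) - H s (φ s y) := fun s t hs hst ht =>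
    (hrate _ hy s t (by linarith) hst (by linarith) fun r hr =>
      hybox r ⟨by linarith [hr.1], by linarith [hr.2]⟩).2
      (hybox s ⟨hs, by linarith⟩) (hybox t ⟨by linarith, ht⟩)
  have hspeed : ∀ z, IsSwitchedCurve T Ω H f₁ f₂ z → (∀ t ∈ Icc a t₂, ‖z t - x₁‖ ≤ η) →
      ∀ s t, a ≤ s → s ≤ t → t ≤ t₂ → ‖z t - z s‖ ≤ V * (t - s) := fun z hz hzb s t hs hst ht =>
    (hrate _ hz s t (by linarith) hst (by linarith) fun r hr =>
      hzb r ⟨by linarith [hr.1], by linarith [hr.2]⟩).1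
  have habs : ∀ r ∈ Icc a t₂, |r - t₁| ≤ η := fun r hr =>
    abs_sub_le_iff.2 ⟨by linarith [hr.2], by linarith [hr.1]⟩
  have hdiff : ∀ r ∈ Icc a t₂, |H r (φ r y) - H r (φ r x₀)| ≤ L * ‖φ r y - φ r x₀‖ := fun r hr =>
    hlip r _ _ (habs r hr) (hybox r hr) (hγbox' r hr)
  have hHa : H a (φ a y) < 0 := (hypre a ⟨ha0, le_rfl⟩).1
  have hHt₂ : 0 < H t₂ (φ t₂ y) := by
    have h1 := hyrate a t₂ le_rfl hat₂ le_rfl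
    have h2 := (abs_le.1 (hdiff a ⟨le_rfl, hat₂⟩)).1
    have h3 : L * ‖φ a y - φ a x₀‖ ≤ L * (C₁ * δ) := by gcongr
    have h4 : κ * σ ≤ κ * (t₂ - a) := by gcongr; linarith
    linarith [hyδ.2]
  obtain ⟨τ, hτ, hτ0⟩ : ∃ τ ∈ Ioo a t₂, H τ (φ τ y) = 0 :=
    intermediate_value_Ioo hat₂ ((hy.continuousOn_comp h.continuousOn).mono hIT) ⟨hHa, hHt₂⟩
  have hyneg : ∀ t ∈ Ico 0 τ, H t (φ t y) < 0 := fun t ht => by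
    rcases le_total t a with hta | hta
    · exact (hypre t ⟨ht.1, hta⟩).1
    · have h1 := hyrate t τ hta ht.2.le hτ.2.le
      have h2 := mul_pos hκ (sub_pos.2 ht.2)
      linarith
  have hypos : ∀ t ∈ Ioc τ t₂, 0 < H t (φ t y) := fun t ht => by
    have h1 := hyrate τ t hτ.1.le ht.1.le ht.2
    have h2 := mul_pos hκ (sub_pos.2 ht.1)
    linarith
  have hclose : ∀ r ∈ Icc a t₂, ‖φ r y - φ r x₀‖ ≤ 2 * η := fun r hr => by
    have := norm_sub_le_norm_sub_add_norm_sub (φ r y) x₁ (φ r x₀)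
    rw [norm_sub_rev x₁] at this
    linarith [hybox r hr, hγbox' r hr]
  set m := min τ t₁ with hm
  set b := max τ t₁ with hb
  have ham : a ≤ m := le_min hτ.1.le hat.le
  have hmb : m ≤ b := min_le_max
  have hbt₂ : b ≤ t₂ := max_le hτ.2.le (by linarith)
  have hm0 : 0 ≤ m := ha0.trans ham
  have hw₁ : ∀ r ∈ Icc 0 m, ‖φ r y - φ r x₀‖ ≤ C₁ * δ := fun r hr => by
    have := htube₁ 0 m (fun t => φ t y) le_rfl (by linarith)
      (hy.isForwardSolution_left h.left_field.continuousOn le_rfl (by linarith)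
        fun r hr => hyneg r ⟨hr.1.le, hr.2.trans_le (min_le_left _ _)⟩)
      (hγ.isForwardSolution_left h.left_field.continuousOn le_rfl (by linarith)
        fun r hr => hneg r ⟨hr.1.le, hr.2.trans_le (min_le_right _ _)⟩)
      (fun r hr => by
        rcases le_total r a with hra | hra
        · exact (hypre r ⟨hr.1, hra⟩).2.1
        · linarith [hclose r ⟨hra, by linarith [hr.2]⟩, hη1]) r hr
    simpa only [hy0, hγ0] using this
  have hzero : H t₁ (φ t₁ x₀) = 0 := h.eq_zero
  have hwm : L * ‖φ m y - φ m x₀‖ ≤ κ * (K₁ * δ) := by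
    calc _ ≤ L * (C₁ * δ) := by gcongr; exact hw₁ m ⟨hm0, le_rfl⟩
      _ = _ := by rw [hK₁]; field_simp
  have htime : b - m ≤ K₁ * δ := by
    refine le_of_mul_le_mul_left (le_trans ?_ hwm) hκ
    have h2 := abs_le.1 (hdiff m ⟨ham, hmb.trans hbt₂⟩)
    rcases le_total τ t₁ with hle | hle
    · rw [show m = τ from min_eq_left hle] at h2 ⊢
      rw [show b = t₁ from max_eq_right hle]
      have h1 := hγmono τ t₁ (by linarith [hτ.1]) hle (by linarith)
      linarith
    · rw [show m = t₁ from min_eq_right hle] at h2 ⊢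
      rw [show b = τ from max_eq_left hle]
      have h1 := hyrate t₁ τ (by linarith) hle hτ.2.le
      linarith
  have hw₂ : ∀ r ∈ Icc m b, ‖φ r y - φ r x₀‖ ≤ K₂ * δ := fun r hr => by
    have h1 := hspeed _ hy hybox m r ham hr.1 (hr.2.trans hbt₂)
    have h2 := hspeed _ hγ hγbox' m r ham hr.1 (hr.2.trans hbt₂)
    have h3 : V * (r - m) ≤ V * (K₁ * δ) := by gcongr; linarith [hr.2]
    have h4 : φ r y - φ r x₀ = (φ r y - φ m y) - (φ r x₀ - φ m x₀) + (φ m y - φ m x₀) := by abel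
    have h5 := hw₁ m ⟨hm0, le_rfl⟩
    rw [h4]
    refine (norm_add_le _ _).trans ?_
    have h6 := norm_sub_le (φ r y - φ m y) (φ r x₀ - φ m x₀)
    rw [hK₂]
    linarith
  have hw₃ : ∀ r ∈ Icc b t₂, ‖φ r y - φ r x₀‖ ≤ C₂ * (K₂ * δ) := fun r hr => by
    have := htube₂ b t₂ (fun t => φ t y) (hm0.trans hmb) ht₂T
      (hy.isForwardSolution_right h.right_field.continuousOn (hm0.trans hmb) ht₂T
        fun r hr => hypos r ⟨(le_max_left _ _).trans_lt hr.1, hr.2.le⟩)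
      (hγ.isForwardSolution_right h.right_field.continuousOn (hm0.trans hmb) ht₂T
        fun r hr => hγpos r ⟨(le_max_right _ _).trans_lt hr.1, hr.2.le⟩)
      (fun r hr => by linarith [hclose r ⟨by linarith [hr.1], hr.2.le⟩, hη2]) r hr
    exact this.trans (by gcongr; exact hw₂ b ⟨hmb, le_rfl⟩)
  have p1 : 0 ≤ K₁ * δ := by positivity
  have p2 : 0 ≤ K₂ * δ := by positivity
  have p3 : 0 ≤ C₂ * K₂ * δ := by positivity
  have p4 : 0 ≤ 2 * V * K₁ * δ := by positivity
  refine ⟨τ, ⟨ha0.trans_lt hτ.1, hτ.2⟩, hyneg, hτ0, hypos, ?_, fun t ht => ?_⟩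
  · have : |τ - t₁| = b - m := by rw [hb, hm, max_sub_min_eq_abs, abs_sub_comm]
    rw [this]; linarith
  · rcases le_total t m with htm | htm
    · have := hw₁ t ⟨ht.1, htm⟩
      rw [hK₂] at p2 p3 ⊢
      linarith
    · rcases le_total t b with htb | htb
      · linarith [hw₂ t ⟨htm, htb⟩]
      · linarith [hw₃ t ⟨htb, ht.2⟩]

end Crossing

/-! ### Differentiability of the flow before and after the crossing. -/

section Flow

theorem isLittleO_clm_apply_sub {E : Type*} [NormedAddCommGroup E] [NormedSpace ℝ E] {x₀ : E}
    {L : E → E →L[ℝ] E} (hL : Tendsto L (𝓝 x₀) (𝓝 0)) :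
    (fun y => L y (y - x₀)) =o[𝓝 x₀] fun y => y - x₀ := by
  rw [Asymptotics.isLittleO_iff]
  intro c hc
  have h1 := hL.norm
  rw [norm_zero] at h1
  filter_upwards [h1.eventually_le_const hc] with y hy
  exact (L y).le_of_opNorm_le hy _

variable {d : ℕ} {T : ℝ} {Ω : Set (Space d)} {H : ℝ → Space d → ℝ}
  {f₁ f₂ : ℝ → Space d → Space d} {t₁ : ℝ} {DH : ℝ × Space d →L[ℝ] ℝ}

/-- The linear map of the saltation matrix: `w ↦ w + (DH(0,w) / c) (vp - vm)`, where
`c = DH(1,vm)` is the crossing rate. -/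
noncomputable def saltationMap (DH : ℝ × Space d →L[ℝ] ℝ) (vm vp : Space d) : Space d →L[ℝ] Space d :=
  1 + ((DH (1, vm))⁻¹ • DH.comp (ContinuousLinearMap.inr ℝ ℝ (Space d))).smulRight (vp - vm)

theorem saltationMap_apply (vm vp w : Space d) :
    saltationMap DH vm vp w = w + ((DH (1, vm))⁻¹ * DH (0, w)) • (vp - vm) := by
  simp [saltationMap]

namespace IsTransversalAt

variable {φ : ℝ → Space d → Space d} {x₀ : Space d} {t₂ K : ℝ} {τ : Space d → ℝ}

/-- Along the crossing, differences of curves are transformed by the saltation map, up to an error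
of higher order. -/
theorem isLittleO_jump (h : IsTransversalAt T Ω H f₁ f₂ t₁ (φ t₁ x₀) DH)
    (hφ : ∀ᶠ y in 𝓝 x₀, IsSwitchedCurve T Ω H f₁ f₂ (fun t => φ t y) ∧ φ 0 y = y)
    (hneg : ∀ t ∈ Ico 0 t₁, H t (φ t x₀) < 0) (ht₂ : t₂ ∈ Ioc t₁ T)
    (hpos : ∀ t ∈ Ioc t₁ t₂, 0 < H t (φ t x₀)) (hK : 0 < K)
    (hτ : ∀ᶠ y in 𝓝 x₀,
      CrossesNear H (fun t => φ t y) (fun t => φ t x₀) t₁ t₂ (K * ‖y - x₀‖) (τ y)) :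
    (fun y => (φ (max (τ y) t₁) y - φ (max (τ y) t₁) x₀) -
      saltationMap DH (f₁ t₁ (φ t₁ x₀)) (f₂ t₁ (φ t₁ x₀))
        (φ (min (τ y) t₁) y - φ (min (τ y) t₁) x₀)) =o[𝓝 x₀] fun y => y - x₀ := by
  obtain ⟨hγ, hγ0⟩ := hφ.self_of_nhds
  obtain ⟨ht0, htT⟩ := h.time_mem
  set x₁ := φ t₁ x₀ with hx₁
  rw [Asymptotics.isLittleO_iff]
  intro e he
  have hη0 : ∀ᶠ η in 𝓝[>] (0 : ℝ), 0 < η := self_mem_nhdsWithin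
  obtain ⟨η, hjump, hη⟩ := ((h.eventually_jump (ε := e / (2 * K)) (by positivity)).and hη0).exists
  have hγc : ContinuousAt (fun t => φ t x₀) t₁ := hγ.continuousOn.continuousAt (Icc_mem_nhds ht0 htT)
  obtain ⟨σ, hσ, hσγ⟩ := Metric.continuousAt_iff.1 hγc (η / 2) (by positivity)
  have hδ : ∀ᶠ y in 𝓝 x₀, K * ‖y - x₀‖ < min σ (η / 2) := by
    have e1 : Tendsto (fun y => K * ‖y - x₀‖) (𝓝 x₀) (𝓝 (K * ‖x₀ - x₀‖)) :=
      Continuous.tendsto (by fun_prop) x₀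
    rw [sub_self, norm_zero, mul_zero] at e1
    exact e1.eventually_lt_const (by positivity)
  filter_upwards [hφ, hτ, hδ] with y ⟨hy, hy0⟩ hyτ hyδ
  have hδσ := hyδ.trans_le (min_le_left _ _)
  have hδη := hyδ.trans_le (min_le_right _ _)
  have htime := abs_le.1 hyτ.time_le
  have hm : t₁ - K * ‖y - x₀‖ ≤ min (τ y) t₁ := le_min (by linarith) (by
    have : 0 ≤ K * ‖y - x₀‖ := by positivity
    linarith)
  have hb : max (τ y) t₁ ≤ t₁ + K * ‖y - x₀‖ := max_le (by linarith) (by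
    have : 0 ≤ K * ‖y - x₀‖ := by positivity
    linarith)
  have hm0 : 0 ≤ min (τ y) t₁ := le_min hyτ.time_mem.1.le ht0.le
  have hbt₂ : max (τ y) t₁ ≤ t₂ := max_le hyτ.time_mem.2.le ht₂.1.le
  have hmb : min (τ y) t₁ ≤ max (τ y) t₁ := min_le_max
  have hγbox : ∀ r ∈ Icc (min (τ y) t₁) (max (τ y) t₁), ‖φ r x₀ - x₁‖ ≤ η / 2 := fun r hr => by
    have : dist r t₁ < σ := by
      rw [Real.dist_eq]
      exact (abs_sub_le_iff.2 ⟨by linarith [hr.2], by linarith [hr.1]⟩).trans_lt hδσ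
    exact (dist_eq_norm (φ r x₀) x₁ ▸ hσγ this).le
  have hγbox' : ∀ r ∈ Icc (min (τ y) t₁) (max (τ y) t₁), ‖φ r x₀ - x₁‖ ≤ η := fun r hr => by
    linarith [hγbox r hr]
  have hybox : ∀ r ∈ Icc (min (τ y) t₁) (max (τ y) t₁), ‖φ r y - x₁‖ ≤ η := fun r hr => by
    have h1 := hyτ.dist_le r ⟨hm0.trans hr.1, hr.2.trans hbt₂⟩
    have h2 := norm_sub_le_norm_sub_add_norm_sub (φ r y) (φ r x₀) x₁
    linarith [hγbox r hr]
  have hdist := hyτ.dist_le _ ⟨hm0, hmb.trans hbt₂⟩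
  have hgoal : e / (2 * K) * ((max (τ y) t₁ - min (τ y) t₁) +
      ‖φ (min (τ y) t₁) y - φ (min (τ y) t₁) x₀‖) ≤ e * ‖y - x₀‖ := by
    have h1 : max (τ y) t₁ - min (τ y) t₁ ≤ K * ‖y - x₀‖ := by
      rw [max_sub_min_eq_abs, abs_sub_comm]; exact hyτ.time_le
    calc _ ≤ e / (2 * K) * (K * ‖y - x₀‖ + K * ‖y - x₀‖) := by gcongr
      _ = _ := by field_simp; ring
  refine le_trans ?_ hgoal
  rw [saltationMap_apply]
  -- The jump estimate takes the earlier curve first. If the reference crosses first, the roles are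
  -- exchanged; the formula is odd in the difference, so only signs change.
  rcases le_total (τ y) t₁ with hle | hle
  · rw [min_eq_left hle, max_eq_right hle] at *
    have h1 := hjump _ _ hy hγ (τ y) t₁ (by linarith) hle (by linarith) hybox hγbox'
      hyτ.eq_zero (fun r hr => hyτ.pos r ⟨hr.1, hr.2.le.trans hbt₂⟩)
      h.eq_zero (fun r hr => hneg r ⟨(hm0.trans_lt hr.1).le, hr.2⟩)
    rwa [sub_sub] at h1
  · rw [min_eq_right hle, max_eq_left hle] at *
    have h1 := hjump _ _ hγ hy t₁ (τ y) (by linarith) hle (by linarith) hγbox' hybox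
      h.eq_zero (fun r hr => hpos r ⟨hr.1, hr.2.le.trans hbt₂⟩)
      hyτ.eq_zero (fun r hr => hyτ.neg r ⟨(hm0.trans_lt hr.1).le, hr.2⟩)
    rw [← norm_neg, norm_sub_rev (φ t₁ x₀)] at h1
    refine (le_of_eq (congrArg norm ?_)).trans h1
    rw [show ((0 : ℝ), φ t₁ x₀ - φ t₁ y) = -((0 : ℝ), φ t₁ y - φ t₁ x₀) by simp, map_neg,
      mul_neg, neg_smul]
    abel

/-- Before the crossing the flow is differentiable, with derivative the fundamental solution. -/
theorem eventually_linear_before (h : IsTransversalAt T Ω H f₁ f₂ t₁ (φ t₁ x₀) DH)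
    (hφ : ∀ᶠ y in 𝓝 x₀, IsSwitchedCurve T Ω H f₁ f₂ (fun t => φ t y) ∧ φ 0 y = y)
    (hneg : ∀ t ∈ Ico 0 t₁, H t (φ t x₀) < 0) (ht₂ : t₂ ∈ Ioc t₁ T) (hK : 0 < K)
    (hτ : ∀ᶠ y in 𝓝 x₀,
      CrossesNear H (fun t => φ t y) (fun t => φ t x₀) t₁ t₂ (K * ‖y - x₀‖) (τ y))
    {Φ : ℝ → Space d →L[ℝ] Space d} (hΦ0 : Φ 0 = 1) (hΦc : ContinuousOn Φ (Icc 0 t₁))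
    (hΦ : ∀ t ∈ Ico 0 t₁, HasDerivWithinAt Φ (fderiv ℝ (f₁ t) (φ t x₀) * Φ t) (Ici t) t)
    {e : ℝ} (he : 0 < e) :
    ∀ᶠ y in 𝓝 x₀, ∀ t ∈ Icc 0 (min (τ y) t₁),
      ‖φ t y - φ t x₀ - Φ t (y - x₀)‖ ≤ e * ‖y - x₀‖ := by
  obtain ⟨hγ, hγ0⟩ := hφ.self_of_nhds
  obtain ⟨ht0, htT⟩ := h.time_mem
  obtain ⟨C, hC, hlin⟩ := h.left_field.exists_linear_tube h.isOpen subset_rfl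
    hγ.continuousOn hγ.mem
  obtain ⟨η, hη, hlin⟩ := hlin (e / K) (by positivity)
  have hδ : ∀ᶠ y in 𝓝 x₀, K * ‖y - x₀‖ < η := by
    have e1 : Tendsto (fun y => K * ‖y - x₀‖) (𝓝 x₀) (𝓝 (K * ‖x₀ - x₀‖)) :=
      Continuous.tendsto (by fun_prop) x₀
    rw [sub_self, norm_zero, mul_zero] at e1
    exact e1.eventually_lt_const hη
  filter_upwards [hφ, hτ, hδ] with y ⟨hy, hy0⟩ hyτ hyδ t ht
  have htτ := ht.2.trans (min_le_left _ _)
  have htt₁ := ht.2.trans (min_le_right _ _)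
  have h1 := hlin 0 t (fun t => φ t y) Φ (y - x₀) (K * ‖y - x₀‖) le_rfl ht.1 (htt₁.trans htT.le)
    (hy.isForwardSolution_left h.left_field.continuousOn le_rfl (htt₁.trans htT.le)
      fun r hr => hyτ.neg r ⟨hr.1.le, hr.2.trans_le htτ⟩)
    (hγ.isForwardSolution_left h.left_field.continuousOn le_rfl (htt₁.trans htT.le)
      fun r hr => hneg r ⟨hr.1.le, hr.2.trans_le htt₁⟩)
    (hΦc.mono (Icc_subset_Icc_right htt₁))
    (fun r hr => hΦ r ⟨hr.1, hr.2.trans_le htt₁⟩)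
    (fun r hr => hyτ.dist_le r ⟨hr.1, by linarith [hr.2, ht₂.1]⟩) (by positivity) hyδ.le
  rw [hy0, hγ0, hΦ0] at h1
  simp only [one_apply_eq_self, sub_self, norm_zero, mul_zero, zero_add] at h1
  refine h1.trans (le_of_eq ?_)
  field_simp

/-- The derivative of the flow of a switched system jumps at a transversal crossing by composition
with the saltation map. -/
theorem exists_tendsto_fderiv (h : IsTransversalAt T Ω H f₁ f₂ t₁ (φ t₁ x₀) DH)
    (hφ : ∀ᶠ y in 𝓝 x₀, IsSwitchedCurve T Ω H f₁ f₂ (fun t => φ t y) ∧ φ 0 y = y)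
    (hneg : ∀ t ∈ Ico 0 t₁, H t (φ t x₀) < 0) :
    (∀ᶠ t in 𝓝[≠] t₁, DifferentiableAt ℝ (φ t) x₀) ∧
    ∃ M N : Space d →L[ℝ] Space d, N * M = 1 ∧
      Tendsto (fun t => fderiv ℝ (φ t) x₀) (𝓝[<] t₁) (𝓝 M) ∧
      Tendsto (fun t => fderiv ℝ (φ t) x₀) (𝓝[>] t₁)
        (𝓝 (saltationMap DH (f₁ t₁ (φ t₁ x₀)) (f₂ t₁ (φ t₁ x₀)) * M)) := by
  obtain ⟨hγ, hγ0⟩ := hφ.self_of_nhds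
  obtain ⟨ht0, htT⟩ := h.time_mem
  obtain ⟨t₂, ht₂, hpos, K, hK, hex⟩ := h.exists_crossesNear hφ hneg
  obtain ⟨τ, hτ⟩ := hex.choice
  have hsub₁ : Icc 0 t₁ ⊆ Icc 0 T := Icc_subset_Icc_right htT.le
  have hsub₂ : Icc t₁ t₂ ⊆ Icc 0 T := Icc_subset_Icc ht0.le ht₂.2
  obtain ⟨Φ₁, Ψ, hΦ₁0, hΦ₁c, hΦ₁, hΨ⟩ := exists_fundamental_solution ht0.le _
    (h.left_field.continuousOn_fderiv_comp hsub₁ (hγ.continuousOn.mono hsub₁)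
      fun t ht => hγ.mem t (hsub₁ ht))
  -- `Φ₂` is normalized at `t₁`, though the joint motion under `f₂` starts at `max (τ y) t₁`; the
  -- discrepancy `Φ₂ (max (τ y) t₁) - 1` tends to `0` as `y → x₀`.
  obtain ⟨Φ₂, -, hΦ₂0, hΦ₂c, hΦ₂, -⟩ := exists_fundamental_solution ht₂.1.le _
    (h.right_field.continuousOn_fderiv_comp hsub₂ (hγ.continuousOn.mono hsub₂)
      fun t ht => hγ.mem t (hsub₂ ht))
  set S := saltationMap DH (f₁ t₁ (φ t₁ x₀)) (f₂ t₁ (φ t₁ x₀)) with hS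
  set M := Φ₁ t₁ with hM
  have hδ : Tendsto (fun y => K * ‖y - x₀‖) (𝓝 x₀) (𝓝 0) := by
    have e1 : Tendsto (fun y => K * ‖y - x₀‖) (𝓝 x₀) (𝓝 (K * ‖x₀ - x₀‖)) :=
      Continuous.tendsto (by fun_prop) x₀
    rwa [sub_self, norm_zero, mul_zero] at e1
  have hτlim : Tendsto τ (𝓝 x₀) (𝓝 t₁) := by
    rw [tendsto_iff_norm_sub_tendsto_zero]
    refine squeeze_zero' (Eventually.of_forall fun _ => norm_nonneg _) ?_ hδ
    filter_upwards [hτ] with y hy using hy.time_le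
  have hbefore : ∀ t ∈ Ioo 0 t₁, HasFDerivAt (φ t) (Φ₁ t) x₀ := fun t ht => by
    rw [hasFDerivAt_iff_isLittleO, Asymptotics.isLittleO_iff]
    intro e he
    filter_upwards [h.eventually_linear_before hφ hneg ht₂ hK hτ hΦ₁0 hΦ₁c hΦ₁ he,
      hτlim.eventually_const_lt ht.2] with y hy hyt
    exact hy t ⟨ht.1.le, le_min hyt.le ht.2.le⟩
  have hmlim : Tendsto (fun y => min (τ y) t₁) (𝓝 x₀) (𝓝 t₁) := by
    simpa using hτlim.min (tendsto_const_nhds (x := t₁))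
  have hblim : Tendsto (fun y => max (τ y) t₁) (𝓝 x₀) (𝓝 t₁) := by
    simpa using hτlim.max (tendsto_const_nhds (x := t₁))
  have hΦ₁m : Tendsto (fun y => Φ₁ (min (τ y) t₁) - M) (𝓝 x₀) (𝓝 0) := by
    have h1 : Tendsto (fun y => Φ₁ (min (τ y) t₁)) (𝓝 x₀) (𝓝 M) :=
      (hΦ₁c t₁ ⟨ht0.le, le_rfl⟩).tendsto.comp (tendsto_nhdsWithin_iff.2 ⟨hmlim, by
        filter_upwards [hτ] with y hy
        exact ⟨le_min hy.time_mem.1.le ht0.le, min_le_right _ _⟩⟩)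
    simpa using h1.sub_const M
  have hΦ₂b : Tendsto (fun y => Φ₂ (max (τ y) t₁) - 1) (𝓝 x₀) (𝓝 0) := by
    have h1 : Tendsto (fun y => Φ₂ (max (τ y) t₁)) (𝓝 x₀) (𝓝 (Φ₂ t₁)) :=
      (hΦ₂c t₁ ⟨le_rfl, ht₂.1.le⟩).tendsto.comp (tendsto_nhdsWithin_iff.2 ⟨hblim, by
        filter_upwards [hτ] with y hy
        exact ⟨le_max_right _ _, max_le hy.time_mem.2.le ht₂.1.le⟩⟩)
    rw [hΦ₂0] at h1
    simpa using h1.sub_const 1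
  have hcross : (fun y => φ (max (τ y) t₁) y - φ (max (τ y) t₁) x₀ -
      Φ₂ (max (τ y) t₁) ((S * M) (y - x₀))) =o[𝓝 x₀] fun y => y - x₀ := by
    have a1 : (fun y => φ (min (τ y) t₁) y - φ (min (τ y) t₁) x₀ -
        Φ₁ (min (τ y) t₁) (y - x₀)) =o[𝓝 x₀] fun y => y - x₀ := by
      rw [Asymptotics.isLittleO_iff]
      intro e he
      filter_upwards [h.eventually_linear_before hφ hneg ht₂ hK hτ hΦ₁0 hΦ₁c hΦ₁ he, hτ]
        with y hy hyτ
      exact hy _ ⟨le_min hyτ.time_mem.1.le ht0.le, le_rfl⟩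
    have a2 := h.isLittleO_jump hφ hneg ht₂ hpos hK hτ
    have a3 := isLittleO_clm_apply_sub hΦ₁m
    have a4 : (fun y => ((Φ₂ (max (τ y) t₁) - 1) * (S * M)) (y - x₀)) =o[𝓝 x₀]
        fun y => y - x₀ := isLittleO_clm_apply_sub (by simpa using hΦ₂b.mul_const (S * M))
    have a5 := (a2.add ((S.isBigO_comp _ _).trans_isLittleO (a1.add a3))).sub a4
    refine a5.congr_left fun y => ?_
    simp only [mul_apply_eq_comp, sub_apply,
      one_apply_eq_self, map_add, map_sub, hS]
    abel
  obtain ⟨C, hC, hlin⟩ := h.right_field.exists_linear_tube h.isOpen subset_rfl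
    hγ.continuousOn hγ.mem
  have hafter : ∀ t ∈ Ioc t₁ t₂, HasFDerivAt (φ t) (Φ₂ t * (S * M)) x₀ := fun t ht => by
    rw [hasFDerivAt_iff_isLittleO, Asymptotics.isLittleO_iff]
    intro e he
    obtain ⟨η, hη, hlin⟩ := hlin (e / (2 * K)) (by positivity)
    filter_upwards [hφ, hτ, hδ.eventually_lt_const hη, hblim.eventually_lt_const ht.1,
      hcross.def (c := e / (2 * C)) (by positivity)] with y ⟨hy, hy0⟩ hyτ hyδ hbt hyc
    have hb0 : 0 ≤ max (τ y) t₁ := le_max_of_le_right ht0.le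
    have htT' := ht.2.trans ht₂.2
    have h1 := hlin (max (τ y) t₁) t (fun t => φ t y) Φ₂ ((S * M) (y - x₀)) (K * ‖y - x₀‖)
      hb0 hbt.le htT'
      (hy.isForwardSolution_right h.right_field.continuousOn hb0 htT'
        fun r hr => hyτ.pos r ⟨(le_max_left _ _).trans_lt hr.1, hr.2.le.trans ht.2⟩)
      (hγ.isForwardSolution_right h.right_field.continuousOn hb0 htT'
        fun r hr => hpos r ⟨(le_max_right _ _).trans_lt hr.1, hr.2.le.trans ht.2⟩)
      (hΦ₂c.mono (Icc_subset_Icc (le_max_right _ _) ht.2))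
      (fun r hr => hΦ₂ r ⟨(le_max_right _ _).trans hr.1, hr.2.trans_le ht.2⟩)
      (fun r hr => hyτ.dist_le r ⟨hb0.trans hr.1, hr.2.le.trans ht.2⟩) (by positivity) hyδ.le
    refine h1.trans ?_
    calc _ ≤ C * (e / (2 * C) * ‖y - x₀‖) + e / (2 * K) * (K * ‖y - x₀‖) := by gcongr
      _ = _ := by field_simp; ring
  have e1 : ∀ᶠ t in 𝓝[<] t₁, HasFDerivAt (φ t) (Φ₁ t) x₀ := by
    filter_upwards [Ioo_mem_nhdsLT ht0] with t ht using hbefore t ht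
  have e2 : ∀ᶠ t in 𝓝[>] t₁, HasFDerivAt (φ t) (Φ₂ t * (S * M)) x₀ := by
    filter_upwards [Ioc_mem_nhdsGT ht₂.1] with t ht using hafter t ht
  refine ⟨?_, M, Ψ t₁, hΨ t₁ ⟨ht0.le, le_rfl⟩, ?_, ?_⟩
  · rw [← Iio_union_Ioi, nhdsWithin_union, eventually_sup]
    exact ⟨e1.mono fun t ht => ht.differentiableAt, e2.mono fun t ht => ht.differentiableAt⟩
  · have h1 : Tendsto Φ₁ (𝓝[<] t₁) (𝓝 M) :=
      (hΦ₁c t₁ ⟨ht0.le, le_rfl⟩).tendsto.mono_left (nhdsWithin_le_of_mem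
        (Filter.mem_of_superset (Ioo_mem_nhdsLT ht0) Ioo_subset_Icc_self))
    exact h1.congr' (e1.mono fun t ht => ht.fderiv.symm)
  · have h1 : Tendsto Φ₂ (𝓝[>] t₁) (𝓝 1) := by
      rw [← hΦ₂0]
      exact (hΦ₂c t₁ ⟨le_rfl, ht₂.1.le⟩).tendsto.mono_left (nhdsWithin_le_of_mem
        (Filter.mem_of_superset (Ioc_mem_nhdsGT ht₂.1) Ioc_subset_Icc_self))
    have h2 : Tendsto (fun t => Φ₂ t * (S * M)) (𝓝[>] t₁) (𝓝 (S * M)) := by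
      simpa using h1.mul_const (S * M)
    exact h2.congr' (e2.mono fun t ht => ht.fderiv.symm)

end IsTransversalAt

end Flow

/-! ### Direction of the crossing and identification of the one-sided velocities. -/

section Sign

theorem neg_or_pos_of_ne_zero {h : ℝ → ℝ} {s : Set ℝ} (hs : IsPreconnected s)
    (hc : ContinuousOn h s) (h0 : ∀ t ∈ s, h t ≠ 0) :
    (∀ t ∈ s, h t < 0) ∨ ∀ t ∈ s, 0 < h t := by
  by_contra! hcon
  obtain ⟨⟨a, ha, ha'⟩, b, hb, hb'⟩ := hcon
  obtain ⟨c, hc, hc0⟩ := hs.intermediate_value hb ha hc ⟨hb', ha'⟩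
  exact h0 c hc hc0

/-- The same convex-ball argument as for forward solutions, from the left. It yields the incoming
velocity at the hitting time, where forward derivatives say nothing about the past. -/
theorem IsSwitchedCurve.hasDerivWithinAt_Iic {E : Type*} [NormedAddCommGroup E] [NormedSpace ℝ E]
    {T : ℝ} {Ω : Set E} {H : ℝ → E → ℝ} {f₁ f₂ : ℝ → E → E} {x : ℝ → E}
    (hx : IsSwitchedCurve T Ω H f₁ f₂ x)
    (hf : ContinuousOn (fun p : ℝ × E => f₁ p.1 p.2) (Icc 0 T ×ˢ Ω)) {t : ℝ} (ht0 : 0 < t)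
    (ht : t ≤ T) (hneg : ∀ r ∈ Ico 0 t, H r (x r) < 0) :
    HasDerivWithinAt x (f₁ t (x t)) (Iic t) t := by
  rw [hasDerivWithinAt_iff_isLittleO, Asymptotics.isLittleO_iff]
  intro c hc
  have hcont := hx.continuousOn_comp hf t ⟨ht0.le, ht⟩
  have hev : ∀ᶠ q in 𝓝[≤] t, f₁ q (x q) ∈ Metric.closedBall (f₁ t (x t)) c ∧ 0 < q := by
    refine Filter.Eventually.and ?_ (nhdsWithin_le_nhds (Ioi_mem_nhds ht0))
    have h1 : 𝓝[≤] t ≤ 𝓝[Icc 0 T] t := by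
      refine nhdsWithin_le_of_mem ?_
      exact Filter.mem_of_superset (Icc_mem_nhdsLE ht0) (Icc_subset_Icc_right ht)
    exact (hcont.mono_left h1) (Metric.closedBall_mem_nhds _ hc)
  obtain ⟨q₀, hq₀, hq⟩ := (mem_nhdsLE_iff_exists_Ioc_subset).1 hev
  filter_upwards [Ioc_mem_nhdsLE hq₀] with q hqm
  rcases hqm.2.eq_or_lt with rfl | hlt
  · simp
  obtain ⟨u, hu, huq⟩ := hx.mean q t (hq hqm).2.le hlt ht
    (Metric.closedBall (f₁ t (x t)) c) Metric.isClosed_closedBall (convex_closedBall _ _)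
    fun p hp =>
      ⟨fun _ => (hq ⟨hqm.1.trans hp.1, hp.2.le⟩).1,
        fun h0 => absurd (hneg p ⟨((hq hqm).2.trans hp.1).le, hp.2⟩) (not_lt.2 h0)⟩
  rw [← neg_sub (x t), huq, ← neg_smul, neg_sub, ← smul_sub, norm_smul, mul_comm]
  exact mul_le_mul_of_nonneg_right (by simpa [dist_eq_norm] using hu) (norm_nonneg _)

variable {d : ℕ} {T : ℝ} {Ω : Set (Space d)} {H : ℝ → Space d → ℝ}
  {v f₁ f₂ : ℝ → Space d → Space d} {t₁ : ℝ} {DH : ℝ × Space d →L[ℝ] ℝ} {γ : ℝ → Space d}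
  {vm vp : Space d}

theorem hasDerivWithinAt_comp_graph {s : Set ℝ} {u : Space d}
    (hH : HasFDerivAt (fun p : ℝ × Space d => H p.1 p.2) DH (t₁, γ t₁))
    (hγ : HasDerivWithinAt γ u s t₁) :
    HasDerivWithinAt (fun t => H t (γ t)) (DH (1, u)) s t₁ :=
  HasFDerivAt.comp_hasDerivWithinAt (f := fun t => (t, γ t))
    (l := fun p : ℝ × Space d => H p.1 p.2) t₁ hH ((hasDerivWithinAt_id t₁ s).prodMk hγ)

/-- A trajectory that hits the switching boundary transversally from below passes to the region
above it. -/
theorem IsSwitchedField.fields_eq_of_neg (hv : IsSwitchedField T Ω H v f₁ f₂)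
    (hHc : ContinuousOn (fun p : ℝ × Space d => H p.1 p.2) (Icc 0 T ×ˢ Ω))
    (hH : HasFDerivAt (fun p : ℝ × Space d => H p.1 p.2) DH (t₁, γ t₁))
    (hγ : IsSwitchedCurve T Ω H f₁ f₂ γ) (ht₁ : t₁ ∈ Ioo 0 T)
    (hneg : ∀ t ∈ Ico 0 t₁, H t (γ t) < 0) (hit : H t₁ (γ t₁) = 0)
    (hafter : ∀ᶠ t in 𝓝[>] t₁, H t (γ t) ≠ 0)
    (hvm : Tendsto (fun t => v t (γ t)) (𝓝[<] t₁) (𝓝 vm))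
    (hvp : Tendsto (fun t => v t (γ t)) (𝓝[>] t₁) (𝓝 vp))
    (htrans : 0 < DH (1, vm) * DH (1, vp)) :
    f₁ t₁ (γ t₁) = vm ∧ f₂ t₁ (γ t₁) = vp ∧ 0 < DH (1, vm) ∧ 0 < DH (1, vp) := by
  obtain ⟨ht0, htT⟩ := ht₁
  have hnhds : Icc 0 T ∈ 𝓝 t₁ := Icc_mem_nhds ht0 htT
  have hlim₁ : Tendsto (fun t => f₁ t (γ t)) (𝓝 t₁) (𝓝 (f₁ t₁ (γ t₁))) :=
    (hγ.continuousOn_comp hv.left_field.continuousOn).continuousAt hnhds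
  have hlim₂ : Tendsto (fun t => f₂ t (γ t)) (𝓝 t₁) (𝓝 (f₂ t₁ (γ t₁))) :=
    (hγ.continuousOn_comp hv.right_field.continuousOn).continuousAt hnhds
  have hm : f₁ t₁ (γ t₁) = vm := by
    refine tendsto_nhds_unique (hlim₁.mono_left nhdsWithin_le_nhds) (hvm.congr' ?_)
    filter_upwards [Ioo_mem_nhdsLT ht0] with t ht
    have htm : t ∈ Icc 0 T := ⟨ht.1.le, (ht.2.trans htT).le⟩
    exact hv.eq_left t htm _ (hγ.mem t htm) (hneg t ⟨ht.1.le, ht.2⟩)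
  -- `H` reaches `0` from below, so its left derivative along `γ` is nonnegative; transversality
  -- excludes zero.
  have hm0 : 0 < DH (1, vm) := by
    have h1 := hasDerivWithinAt_comp_graph hH
      (hγ.hasDerivWithinAt_Iic hv.left_field.continuousOn ht0 htT.le hneg)
    rw [hm, ← hasDerivWithinAt_Iio_iff_Iic, hasDerivWithinAt_iff_tendsto_slope' (by simp)] at h1
    refine lt_of_le_of_ne (ge_of_tendsto h1 ?_) (left_ne_zero_of_mul htrans.ne').symm
    filter_upwards [Ioo_mem_nhdsLT ht0] with t ht
    rw [slope_def_field, hit, sub_zero]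
    exact div_nonneg_of_nonpos (hneg t ⟨ht.1.le, ht.2⟩).le (by linarith [ht.2])
  obtain ⟨b, hb, hbne⟩ : ∃ b ∈ Ioc t₁ T, ∀ t ∈ Ioo t₁ b, H t (γ t) ≠ 0 := by
    obtain ⟨b, hb, h1⟩ := (mem_nhdsGT_iff_exists_Ioo_subset).1 hafter
    exact ⟨min b T, ⟨lt_min hb htT, min_le_right _ _⟩,
      fun t ht => h1 ⟨ht.1, ht.2.trans_le (min_le_left _ _)⟩⟩
  have hsub : Ioo t₁ b ⊆ Icc 0 T := fun t ht => ⟨(ht0.trans ht.1).le, ht.2.le.trans hb.2⟩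
  -- If `γ` returned to `H < 0`, it would still follow `f₁`, and `H` would have right derivative `DH
  -- (1, vm) > 0` while decreasing from `0`.
  have hpos : ∀ t ∈ Ioo t₁ b, 0 < H t (γ t) := by
    refine (neg_or_pos_of_ne_zero isPreconnected_Ioo
      ((hγ.continuousOn_comp hHc).mono hsub) hbne).resolve_left fun hcon => ?_
    have h1 := hasDerivWithinAt_comp_graph hH
      ((hγ.isForwardSolution_left hv.left_field.continuousOn ht0.le hb.2 hcon).hasDeriv t₁
        ⟨le_rfl, hb.1⟩)
    rw [hm, ← hasDerivWithinAt_Ioi_iff_Ici, hasDerivWithinAt_iff_tendsto_slope' (by simp)] at h1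
    refine absurd (le_of_tendsto h1 ?_) (not_le.2 hm0)
    filter_upwards [Ioo_mem_nhdsGT hb.1] with t ht
    rw [slope_def_field, hit, sub_zero]
    exact div_nonpos_of_nonpos_of_nonneg (hcon t ht).le (by linarith [ht.1])
  refine ⟨hm, ?_, hm0, pos_of_mul_pos_right htrans hm0.le⟩
  refine tendsto_nhds_unique (hlim₂.mono_left nhdsWithin_le_nhds) (hvp.congr' ?_)
  filter_upwards [Ioo_mem_nhdsGT hb.1] with t ht
  exact hv.eq_right t (hsub ht) _ (hγ.mem t (hsub ht)) (hpos t ht)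

theorem gradient_and_timeDeriv_of_hasFDerivAt {x₁ : Space d}
    (hH : HasFDerivAt (fun p : ℝ × Space d => H p.1 p.2) DH (t₁, x₁)) :
    (∀ w, inner ℝ (gradient (H t₁) x₁) w = DH (0, w)) ∧ timeDeriv H t₁ x₁ = DH (1, 0) := by
  constructor
  · intro w
    have h1 : HasFDerivAt (H t₁) (DH.comp (ContinuousLinearMap.inr ℝ ℝ (Space d))) x₁ :=
      hH.comp x₁ (hasFDerivAt_prodMk_right t₁ x₁)
    rw [gradient, InnerProductSpace.toDual_symm_apply, h1.fderiv]
    simp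
  · have h1 : HasDerivAt (fun s => H s x₁) (DH (1, 0)) t₁ :=
      HasFDerivAt.comp_hasDerivAt (f := fun t => (t, x₁))
        (l := fun p : ℝ × Space d => H p.1 p.2) t₁ hH ((hasDerivAt_id t₁).prodMk (hasDerivAt_const t₁ x₁))
    exact h1.deriv

end Sign

/-! ### From linear maps to matrices. -/

section Matrices

variable {d : ℕ}

/-- The matrix of a linear map in the standard basis. -/
noncomputable def matrixOf (L : Space d →L[ℝ] Space d) : Matrix (Fin d) (Fin d) ℝ :=
  Matrix.of fun i j => L (EuclideanSpace.single j 1) i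

theorem matrixOf_one : matrixOf (1 : Space d →L[ℝ] Space d) = 1 := by
  ext i j
  simp [matrixOf, Matrix.one_apply, PiLp.single_apply]

theorem matrixOf_mul (A B : Space d →L[ℝ] Space d) :
    matrixOf (A * B) = matrixOf A * matrixOf B := by
  ext i j
  have h1 : B (EuclideanSpace.single j 1) =
      ∑ k, B (EuclideanSpace.single j 1) k • EuclideanSpace.single k (1 : ℝ) := by
    simpa using ((EuclideanSpace.basisFun (Fin d) ℝ).sum_repr (B (EuclideanSpace.single j 1))).symm
  rw [Matrix.mul_apply]
  simp only [matrixOf, Matrix.of_apply, mul_apply_eq_comp]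
  conv_lhs => rw [h1, map_sum]
  simp [mul_comm]

theorem continuous_matrixOf : Continuous (matrixOf (d := d)) := by
  refine continuous_matrix fun i j => ?_
  simp only [matrixOf, Matrix.of_apply]
  fun_prop

/-- The saltation matrix is unique, and it is the matrix of the linear map by which the derivative
of the flow jumps. -/
theorem isSaltationMatrix_iff {φ : ℝ → Space d → Space d} {t₁ : ℝ} {x₀ : Space d}
    {L : Space d →L[ℝ] Space d}
    (h : (∀ᶠ t in 𝓝[≠] t₁, DifferentiableAt ℝ (φ t) x₀) ∧
      ∃ M N : Space d →L[ℝ] Space d, N * M = 1 ∧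
        Tendsto (fun t => fderiv ℝ (φ t) x₀) (𝓝[<] t₁) (𝓝 M) ∧
        Tendsto (fun t => fderiv ℝ (φ t) x₀) (𝓝[>] t₁) (𝓝 (L * M)))
    (S : Matrix (Fin d) (Fin d) ℝ) : IsSaltationMatrix φ t₁ x₀ S ↔ S = matrixOf L := by
  obtain ⟨hd, M, N, hNM, hM, hLM⟩ := h
  have h1 : Tendsto (fun t => fundMatrix φ t x₀) (𝓝[<] t₁) (𝓝 (matrixOf M)) :=
    (continuous_matrixOf.tendsto M).comp hM
  have h2 : Tendsto (fun t => fundMatrix φ t x₀) (𝓝[>] t₁) (𝓝 (matrixOf L * matrixOf M)) := by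
    rw [← matrixOf_mul]
    exact (continuous_matrixOf.tendsto _).comp hLM
  -- For square matrices the left inverse is also a right inverse, which is what cancels `M` in `S *
  -- M = L * M`.
  have h3 : matrixOf M * matrixOf N = 1 := by
    rw [mul_eq_one_comm, ← matrixOf_mul, hNM, matrixOf_one]
  constructor
  · rintro ⟨-, M₁, M₂, hM₁, hM₂, rfl⟩
    have e1 := tendsto_nhds_unique hM₁ h1
    have e2 := tendsto_nhds_unique hM₂ h2
    rw [e1] at e2
    have e3 := congrArg (· * matrixOf N) e2
    simpa [Matrix.mul_assoc, h3] using e3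
  · rintro rfl
    exact ⟨hd, _, _, h1, h2, rfl⟩

/-- Both `DH (0, ·)` and `DH (1, vm)` carry a factor `‖∇H‖` once written with the unit normal, and
it cancels in the quotient. -/
theorem matrixOf_saltationMap {H : ℝ → Space d → ℝ} {t₁ : ℝ} {x₁ : Space d}
    {DH : ℝ × Space d →L[ℝ] ℝ} (hgrad : ∀ w, inner ℝ (gradient (H t₁) x₁) w = DH (0, w))
    (htime : timeDeriv H t₁ x₁ = DH (1, 0)) (hne : gradient (H t₁) x₁ ≠ 0) (vm vp : Space d) :
    matrixOf (saltationMap DH vm vp) =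
      1 + (inner ℝ (unitNormal H t₁ x₁) vm + timeDeriv H t₁ x₁ / ‖gradient (H t₁) x₁‖)⁻¹ •
        Matrix.vecMulVec (vp - vm).ofLp (unitNormal H t₁ x₁).ofLp := by
  have hG : ‖gradient (H t₁) x₁‖ ≠ 0 := norm_ne_zero_iff.2 hne
  have hrate : inner ℝ (unitNormal H t₁ x₁) vm + timeDeriv H t₁ x₁ / ‖gradient (H t₁) x₁‖ =
      ‖gradient (H t₁) x₁‖⁻¹ * DH (1, vm) := by
    have : DH (1, vm) = DH (0, vm) + DH (1, 0) := by rw [← map_add]; simp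
    rw [unitNormal, real_inner_smul_left, hgrad, htime, this]
    ring
  have hcoord : ∀ j, DH (0, EuclideanSpace.single j 1) = gradient (H t₁) x₁ j := fun j => by
    rw [← hgrad, real_inner_comm, EuclideanSpace.inner_single_left]; simp
  rw [hrate]
  ext i j
  simp only [matrixOf, Matrix.of_apply, saltationMap_apply, hcoord, Matrix.add_apply,
    Matrix.smul_apply, Matrix.vecMulVec_apply, unitNormal, PiLp.add_apply, PiLp.smul_apply,
    smul_eq_mul, Matrix.one_apply, PiLp.single_apply, mul_inv, inv_inv]
  field_simp

/-- `DH` enters once linearly and once inverted, so its sign cancels; this lets downward crossings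
be treated as upward ones. -/
theorem saltationMap_neg (DH : ℝ × Space d →L[ℝ] ℝ) (vm vp : Space d) :
    saltationMap (-DH) vm vp = saltationMap DH vm vp := by
  ext1 w
  rw [saltationMap_apply, saltationMap_apply]
  simp [inv_neg]

end Matrices

/-! ### Reduction to upward crossings and conclusion. -/

theorem IsSwitchedField.symm {d : ℕ} {T : ℝ} {Ω : Set (Space d)} {H : ℝ → Space d → ℝ}
    {v f₁ f₂ : ℝ → Space d → Space d} (hv : IsSwitchedField T Ω H v f₁ f₂) :
    IsSwitchedField T Ω (fun t x => -H t x) v f₂ f₁ where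
  left_field := hv.right_field
  right_field := hv.left_field
  eq_left t ht x hx h := hv.eq_right t ht x hx (neg_lt_zero.1 h)
  eq_right t ht x hx h := hv.eq_left t ht x hx (neg_pos.1 h)

/-- The saltation matrix of a transversal crossing from `H < 0` to `H > 0`. -/
theorem IsSwitchedField.isSaltationMatrix_iff_of_neg {d : ℕ} {T : ℝ} {Ω : Set (Space d)}
    {H : ℝ → Space d → ℝ} {v f₁ f₂ : ℝ → Space d → Space d} {DH : ℝ × Space d →L[ℝ] ℝ}
    {φ : ℝ → Space d → Space d} {x₀ : Space d} {t₁ : ℝ} {vm vp : Space d} (hΩ : IsOpen Ω)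
    (hv : IsSwitchedField T Ω H v f₁ f₂)
    (hHc : ContinuousOn (fun p : ℝ × Space d => H p.1 p.2) (Icc 0 T ×ˢ Ω))
    (hH : HasStrictFDerivAt (fun p : ℝ × Space d => H p.1 p.2) DH (t₁, φ t₁ x₀))
    (hφ : ∀ᶠ y in 𝓝 x₀, IsSwitchedCurve T Ω H f₁ f₂ (fun t => φ t y) ∧ φ 0 y = y)
    (ht₁ : t₁ ∈ Ioo 0 T) (hneg : ∀ t ∈ Ico 0 t₁, H t (φ t x₀) < 0)
    (hit : H t₁ (φ t₁ x₀) = 0) (hafter : ∀ᶠ t in 𝓝[>] t₁, H t (φ t x₀) ≠ 0)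
    (hvm : Tendsto (fun t => v t (φ t x₀)) (𝓝[<] t₁) (𝓝 vm))
    (hvp : Tendsto (fun t => v t (φ t x₀)) (𝓝[>] t₁) (𝓝 vp))
    (htrans : 0 < DH (1, vm) * DH (1, vp)) (S : Matrix (Fin d) (Fin d) ℝ) :
    IsSaltationMatrix φ t₁ x₀ S ↔ S = matrixOf (saltationMap DH vm vp) := by
  have hγ := hφ.self_of_nhds.1
  obtain ⟨hm, hp, hm0, hp0⟩ := hv.fields_eq_of_neg (γ := fun t => φ t x₀) hHc hH.hasFDerivAt hγ ht₁
    hneg hit hafter hvm hvp htrans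
  have htr : IsTransversalAt T Ω H f₁ f₂ t₁ (φ t₁ x₀) DH :=
    ⟨hΩ, ht₁, hγ.mem t₁ ⟨ht₁.1.le, ht₁.2.le⟩, hv.left_field, hv.right_field, hHc, hH, hit,
      by rwa [hm], by rwa [hp]⟩
  have := htr.exists_tendsto_fderiv hφ hneg
  rw [hm, hp] at this
  exact isSaltationMatrix_iff this S

end Saltation

theorem mainTheorem1 {d : ℕ} (T : ℝ) (Ω : Set (Saltation.Space d)) (hΩ : IsOpen Ω)
    (H : ℝ → Saltation.Space d → ℝ)
    (hH : ContDiffOn ℝ 1 (fun p : ℝ × Saltation.Space d => H p.1 p.2) (Set.Icc 0 T ×ˢ Ω))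
    (v f₁ f₂ : ℝ → Saltation.Space d → Saltation.Space d)
    (hv : Saltation.IsSwitchedField T Ω H v f₁ f₂)
    (φ : ℝ → Saltation.Space d → Saltation.Space d) (x₀ : Saltation.Space d)
    (hφ : ∀ᶠ y in nhds x₀,
      Saltation.IsFilippovSolution T Ω H v f₁ f₂ y (fun t => φ t y))
    (t₁ : ℝ) (ht₁ : t₁ ∈ Set.Ioo 0 T)
    (x₁ : Saltation.Space d) (hx₁ : φ t₁ x₀ = x₁)
    (vm vp : Saltation.Space d)
    (hcross : Saltation.CrossesTransversally H v (fun t => φ t x₀) t₁ vm vp)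
    (n : Saltation.Space d) (hn : n = Saltation.unitNormal H t₁ x₁) :
    (∀ S : Matrix (Fin d) (Fin d) ℝ,
      Saltation.IsSaltationMatrix φ t₁ x₀ S ↔
        S = 1 + (inner ℝ n vm
              + Saltation.timeDeriv H t₁ x₁ / ‖gradient (H t₁) x₁‖)⁻¹ •
            Matrix.vecMulVec (vp - vm).ofLp n.ofLp) ∧
    (‖gradient (H t₁) x₁‖ = 1 →
      ∀ S : Matrix (Fin d) (Fin d) ℝ,
        Saltation.IsSaltationMatrix φ t₁ x₀ S ↔
          S = 1 + (inner ℝ n vm + Saltation.timeDeriv H t₁ x₁)⁻¹ •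
              Matrix.vecMulVec (vp - vm).ofLp n.ofLp) := by
  subst hn hx₁
  have hT : 0 ≤ T := (ht₁.1.trans ht₁.2).le
  have hφ' : ∀ᶠ y in 𝓝 x₀,
      Saltation.IsSwitchedCurve T Ω H f₁ f₂ (fun t => φ t y) ∧ φ 0 y = y := by
    filter_upwards [hφ] with y hy
    refine ⟨hy.isSwitchedCurve hv hT, ?_⟩
    obtain ⟨-, g, -, hg, -⟩ := hy
    simpa using hg 0 ⟨le_rfl, hT⟩
  have hγ := hφ'.self_of_nhds.1
  have hmem : Icc 0 T ×ˢ Ω ∈ 𝓝 (t₁, φ t₁ x₀) :=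
    prod_mem_nhds (Icc_mem_nhds ht₁.1 ht₁.2) (hΩ.mem_nhds (hγ.mem t₁ ⟨ht₁.1.le, ht₁.2.le⟩))
  -- The crossing point is interior to `[0, T] × Ω`, so `C¹` on that set gives strict
  -- differentiability there.
  have hstrict := (hH.contDiffAt hmem).hasStrictFDerivAt one_ne_zero
  set DH := fderiv ℝ (fun p : ℝ × Saltation.Space d => H p.1 p.2) (t₁, φ t₁ x₀) with hDH
  obtain ⟨hgrad, htime⟩ := Saltation.gradient_and_timeDeriv_of_hasFDerivAt hstrict.hasFDerivAt
  have hrate : ∀ w, Saltation.crossingRate H t₁ (φ t₁ x₀) w = DH (1, w) := fun w => by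
    rw [Saltation.crossingRate, hgrad, htime, ← map_add]; simp
  have htrans := hcross.transversal
  simp only [hrate] at htrans
  have hsalt : ∀ S, Saltation.IsSaltationMatrix φ t₁ x₀ S ↔
      S = Saltation.matrixOf (Saltation.saltationMap DH vm vp) := fun S => by
    have hsub : Ico 0 t₁ ⊆ Icc 0 T := fun t ht => ⟨ht.1, (ht.2.trans ht₁.2).le⟩
    -- Before `t₁` the sign of `H` along the trajectory is constant. If it is positive, the pair
    -- `-H` and `f₂, f₁` gives an upward crossing with the same velocities `vm`, `vp`.
    rcases Saltation.neg_or_pos_of_ne_zero isPreconnected_Ico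
      ((hγ.continuousOn_comp hH.continuousOn).mono hsub) hcross.before with hneg | hpos
    · exact hv.isSaltationMatrix_iff_of_neg hΩ hH.continuousOn hstrict hφ' ht₁ hneg hcross.hit
        hcross.after hcross.velocity_before hcross.velocity_after htrans S
    · rw [← Saltation.saltationMap_neg]
      exact hv.symm.isSaltationMatrix_iff_of_neg hΩ hH.continuousOn.neg hstrict.neg
        (hφ'.mono fun y hy => ⟨hy.1.symm, hy.2⟩) ht₁ (fun t ht => neg_neg_of_pos (hpos t ht))
        (neg_eq_zero.2 hcross.hit) (hcross.after.mono fun t ht => neg_ne_zero.2 ht)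
        hcross.velocity_before hcross.velocity_after (by simpa using htrans) S
  rw [Saltation.matrixOf_saltationMap hgrad htime hcross.gradient_ne_zero] at hsalt
  refine ⟨hsalt, fun hnorm => ?_⟩
  simpa only [hnorm, div_one] using hsalt
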